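/- Let $M$ be an ordered matroid, i.e. a matroid on a finite ground set $E$ together with a total order on $E$. For $A\subseteq E$, call $x\in E$ active with respect to $A$ if there is a circuit $C$ of $M$ with $x\in C\subseteq A\cup\{x\}$ and $x=\min C$; let $\mathrm{EP}(A)$ be the set of $x\in E\setminus A$ that are not active with respect to $A$. The generalized external order $\leq_{\mathrm{ext}}$ on the independent sets of $M$ is given by $I\leq_{\mathrm{ext}} J$ if and only if $\mathrm{EP}(I)\subseteq \mathrm{EP}(J)$. For a finite lattice $L$ we use the following terms. - $L$ is join-distributive if it is semimodular ($x\wedge y\lessdot x$ implies $y\lessdot x\vee y$) and meet-semidistributive ($x\wedge z=y\wedge z$ implies $(x\vee y)\wedge z=x\wedge z$). - $L$ is matroidal if the covering rank $r_{\mathrm{cov}}(x)=\#\{y\in L: x\lessdot y\}$ is weakly decreasing in $x$ and satisfies $r_{\mathrm{cov}}(x\wedge y)+r_{\mathrm{cov}}(x\vee y)\leq r_{\mathrm{cov}}(x)+r_{\mathrm{cov}}(y)$ for all $x,y\in L$. - $L$ is $S_n$ EL-shellable if it is graded, of some rank $n$, and there is an integer labeling of its covering pairs such that every interval $[x,y]$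 has a unique maximal chain with (weakly) increasing label sequence, every other maximal chain of $[x,y]$ has a lexicographically greater label sequence, and the label sequence of every maximal chain of $L$ is a permutation of $1,\dots,n$. - $L$ is supersolvable if it has a maximal chain $\Delta$ such that for every chain $K$ of $L$ the sublattice generated by $\Delta\cup K$ is distributive. **Theorem.** A finite (nonempty) lattice $L$ is isomorphic to the generalized external order $\leq_{\mathrm{ext}}$ of some ordered matroid if and only if $L$ is join-distributive, matroidal, and $S_n$ EL-shellable. Likewise, $L$ is isomorphic to the generalized external order of some ordered matroid if and only if $L$ is join-distributive, matroidal, and supersolvable. -/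

import Mathlib

universe u v

/-! ### Ordered matroids and the generalized external order -/

section ExternalOrder

variable {α : Type*} [LinearOrder α]

/-- The elements `x` of the ground set that are `M`-active with respect to `A`: some circuit `C`
with `x ∈ C ⊆ A ∪ {x}` has `x` as its smallest element. -/
def Matroid.activeSet (M : Matroid α) (A : Set α) : Set α :=
  {x | ∃ C, M.IsCircuit C ∧ x ∈ C ∧ C ⊆ insert x A ∧ ∀ y ∈ C, x ≤ y}

/-- The externally active elements `EA(A) = Act(A) \ A`. -/
def Matroid.extActive (M : Matroid α) (A : Set α) : Set α :=
  M.activeSet A \ A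

/-- The externally passive elements `EP(A) = (E \ A) \ EA(A)`. -/
def Matroid.extPassive (M : Matroid α) (A : Set α) : Set α :=
  (M.E \ A) \ M.extActive A

/-- The independent sets of `M`, as the carrier of the external order. -/
def Matroid.ExternalOrder (M : Matroid α) : Type _ :=
  {I : Set α // M.Indep I}

/-- The generalized external order: `I ≤ J` iff `EP(I) ⊆ EP(J)`. -/
instance Matroid.ExternalOrder.instPreorder (M : Matroid α) : Preorder M.ExternalOrder :=
  Preorder.lift fun I => M.extPassive I.1

end ExternalOrder

/-! ### Join-distributive and matroidal lattices -/

section Lattices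

variable (L : Type*) [Lattice L]

/-- The meet semidistributive law. -/
def IsMeetSemidistributive : Prop :=
  ∀ x y z : L, x ⊓ z = y ⊓ z → (x ⊔ y) ⊓ z = x ⊓ z

/-- Join-distributive: (upper) semimodular and meet semidistributive.
`IsUpperModularLattice L` says that `x ⊓ y ⋖ x` implies `y ⋖ x ⊔ y`. -/
def IsJoinDistributive : Prop :=
  IsUpperModularLattice L ∧ IsMeetSemidistributive L

variable {L} in
/-- The covering rank of `x`: the number of elements that cover `x`. -/
noncomputable def coveringRank (x : L) : ℕ :=
  {y : L | x ⋖ y}.ncard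

/-- The covering rank function is (weakly) decreasing and semimodular. -/
def IsMatroidalLattice : Prop :=
  Antitone (coveringRank (L := L)) ∧
    ∀ x y : L, coveringRank (x ⊓ y) + coveringRank (x ⊔ y) ≤ coveringRank x + coveringRank y

/-- Supersolvable: there is a maximal chain `D` such that for every chain `K` the
sublattice generated by `D` and `K` is distributive. -/
def IsSupersolvable : Prop :=
  ∃ D : Set L, IsMaxChain (· ≤ ·) D ∧ ∀ K : Set L, IsChain (· ≤ ·) K →
    ∀ a ∈ latticeClosure (D ∪ K), ∀ b ∈ latticeClosure (D ∪ K), ∀ c ∈ latticeClosure (D ∪ K),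
      a ⊓ (b ⊔ c) = (a ⊓ b) ⊔ (a ⊓ c)

end Lattices

/-! ### Edge labelings of finite posets -/

section EdgeLabelings

variable {P : Type*} [PartialOrder P]

/-- `m` lists an unrefinable chain `x = x₀ ⋖ x₁ ⋖ ⋯ ⋖ x_k = y`, i.e. (in a finite poset) a
maximal chain of the interval `[x, y]`. -/
def IsUnrefinableChain (x y : P) (m : List P) : Prop :=
  m.IsChain (· ⋖ ·) ∧ m.head? = some x ∧ m.getLast? = some y

/-- `m` lists a maximal chain of the finite poset `P`. -/
def IsMaximalChainList (m : List P) : Prop :=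
  ∃ x y : P, IsMin x ∧ IsMax y ∧ IsUnrefinableChain x y m

variable (P) in
/-- Every maximal chain of the finite poset `P` has length `n`. -/
def IsGradedOfRank (n : ℕ) : Prop :=
  ∀ m : List P, IsMaximalChainList m → m.length = n + 1

/-- The label sequence of the chain listed by `m`. An edge labeling is given by a function of two
elements, of which only the values on covering pairs are ever used. -/
def labelSeq (lab : P → P → ℤ) (m : List P) : List ℤ :=
  List.zipWith lab m m.tail

/-- EL-labeling: every interval `[x, y]` has a unique increasing maximal chain, and
every other maximal chain of `[x, y]` has a lexicographically greater label sequence. -/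
def IsELLabeling (lab : P → P → ℤ) : Prop :=
  ∀ x y : P, x ≤ y → ∃ m₀ : List P,
    IsUnrefinableChain x y m₀ ∧ (labelSeq lab m₀).Pairwise (· ≤ ·) ∧
    ∀ m : List P, IsUnrefinableChain x y m → m ≠ m₀ →
      ¬ (labelSeq lab m).Pairwise (· ≤ ·) ∧ labelSeq lab m₀ < labelSeq lab m

variable (P) in
/-- `S_n` EL-shellable: `P` is graded, of some rank `n`, and has an EL-labeling for which the
label sequence of each maximal chain is a permutation of `1, …, n`. -/
def IsSnELShellable : Prop :=
  ∃ n : ℕ, IsGradedOfRank P n ∧ ∃ lab : P → P → ℤ, IsELLabeling lab ∧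
    ∀ m : List P, IsMaximalChainList m →
      (labelSeq lab m).Perm ((List.range n).map fun i => (i : ℤ) + 1)

end EdgeLabelings

/-! Everything passes through `IsSupersolvableRep`: an order embedding of `L` into finite sets that
turns joins into unions and in which the first element of `φ b \ φ a` may always be added to `φ a`.
Covers then add one element each, which is their label.

From an ordered matroid, the sets `EP(I)` are exactly the `F` no element of which is spanned by
larger elements outside `F`; `greedyBasis` of the complement inverts `EP`. They form such a
representation for the reversed order (`isSupersolvableRep_passiveRep`). The labels of the covers of
`x` form a basis of the complement of `φ x`, so the covering rank is a matroid rank and `L` is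
matroidal. Any representation gives join-distributivity; once its elements are renumbered `0, …, n -
1`, cover labels give an EL-labeling and initial segments a supersolving chain.

Conversely, a representation arises from supersolvability by sending `x` to the meet-irreducibles
not above it, ordered by where the chain leaves their lower sets, and from an `S_n` EL-labeling by
sending `x` to the labels on a chain from `⊥` to `x`. If `L` is also matroidal, the covering rank of
the largest `x` with `φ x` disjoint from `A` is a matroid rank function of `A`. Its independent sets
are the sets `coverLabels φ x`, and `extPassive_coverLabels` shows `EP(coverLabels φ x) = φ x`. -/

/-! ### Supersolvable antimatroid representations -/

/-- A representation of the lattice `L` by the feasible sets of an antimatroid that is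
supersolvable with respect to `le`: whenever `b ≰ a`, the `le`-least element of `φ b \ φ a` may be
added to `φ a`. -/
structure IsSupersolvableRep {L β : Type*} [Lattice L] [DecidableEq β] (le : β → β → Prop)
    (φ : L → Finset β) : Prop where
  subset_iff : ∀ {x y}, φ x ⊆ φ y ↔ x ≤ y
  map_sup : ∀ x y, φ (x ⊔ y) = φ x ∪ φ y
  exists_empty : ∃ x, φ x = ∅
  exists_insert : ∀ {a b e}, e ∈ φ b → e ∉ φ a → (∀ f ∈ φ b, f ∉ φ a → le e f) →
    ∃ c, φ c = insert e (φ a)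

namespace IsSupersolvableRep

section Basic

variable {L β : Type*} [Lattice L] [DecidableEq β] {le : β → β → Prop} {φ : L → Finset β}

lemma injective (h : IsSupersolvableRep le φ) : Function.Injective φ := fun _ _ hxy =>
  le_antisymm (h.subset_iff.1 hxy.subset) (h.subset_iff.1 hxy.symm.subset)

lemma map_bot [OrderBot L] (h : IsSupersolvableRep le φ) : φ ⊥ = ∅ := by
  obtain ⟨x, hx⟩ := h.exists_empty
  exact Finset.subset_empty.1 (hx ▸ h.subset_iff.2 bot_le)

lemma ssubset_iff (h : IsSupersolvableRep le φ) {x y : L} : φ x ⊂ φ y ↔ x < y := by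
  rw [Finset.ssubset_def, lt_iff_le_not_ge, h.subset_iff, h.subset_iff]

lemma covBy_of_insert (h : IsSupersolvableRep le φ) {x y : L} {e : β} (he : e ∉ φ x)
    (hy : φ y = insert e (φ x)) : x ⋖ y := by
  refine ⟨h.ssubset_iff.1 (hy ▸ Finset.ssubset_insert he), fun z hxz hzy => ?_⟩
  have h1 := Finset.card_lt_card (h.ssubset_iff.2 hxz)
  have h2 := Finset.card_lt_card (h.ssubset_iff.2 hzy)
  rw [hy, Finset.card_insert_of_notMem he] at h2
  omega

end Basic

section Extension

variable {L β γ : Type*} [Lattice L] [DecidableEq β] [LinearOrder γ] {ρ : β → γ}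
  {φ : L → Finset β}

/-- If `b ≰ a`, the first element of `φ b \ φ a` can be added to `φ a`. -/
lemma exists_first (h : IsSupersolvableRep (fun a b => ρ a ≤ ρ b) φ) {a b : L} (hab : ¬ b ≤ a) :
    ∃ e ∈ φ b, e ∉ φ a ∧ (∀ f ∈ φ b, f ∉ φ a → ρ e ≤ ρ f) ∧
      ∃ c, φ c = insert e (φ a) ∧ a ⋖ c ∧ c ≤ a ⊔ b := by
  have hne : (φ b \ φ a).Nonempty := by
    rw [Finset.sdiff_nonempty]
    exact fun hh => hab (h.subset_iff.1 hh)
  obtain ⟨e, he, hmin⟩ := Finset.exists_min_image _ ρ hne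
  rw [Finset.mem_sdiff] at he
  have hmin' : ∀ f ∈ φ b, f ∉ φ a → ρ e ≤ ρ f := fun f hf hf' =>
    hmin f (Finset.mem_sdiff.2 ⟨hf, hf'⟩)
  obtain ⟨c, hc⟩ := h.exists_insert he.1 he.2 hmin'
  refine ⟨e, he.1, he.2, hmin', c, hc, h.covBy_of_insert he.2 hc, ?_⟩
  rw [← h.subset_iff, hc, h.map_sup]
  exact Finset.insert_subset (Finset.mem_union_right _ he.1) Finset.subset_union_left

lemma covBy_iff (h : IsSupersolvableRep (fun a b => ρ a ≤ ρ b) φ) {x y : L} :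
    x ⋖ y ↔ ∃ e, e ∉ φ x ∧ φ y = insert e (φ x) := by
  refine ⟨fun hxy => ?_, fun ⟨e, he, hy⟩ => h.covBy_of_insert he hy⟩
  obtain ⟨e, -, he, -, c, hc, hac, hcy⟩ := h.exists_first hxy.lt.not_ge
  rw [sup_eq_right.2 hxy.le] at hcy
  obtain hlt | rfl := hcy.lt_or_eq
  · exact (hxy.2 hac.lt hlt).elim
  · exact ⟨e, he, hc⟩

/-- A lattice with a supersolvable representation is join-distributive. -/
lemma isJoinDistributive (h : IsSupersolvableRep (fun a b => ρ a ≤ ρ b) φ) :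
    IsJoinDistributive L := by
  refine ⟨⟨fun {x y} hxy => ?_⟩, fun x y z hxyz => ?_⟩
  · obtain ⟨e, he, hx⟩ := h.covBy_iff.1 hxy
    refine h.covBy_iff.2 ⟨e, fun hey => ?_, ?_⟩
    · refine hxy.lt.not_ge (le_inf le_rfl (h.subset_iff.1 ?_))
      rw [hx]
      exact Finset.insert_subset hey (h.subset_iff.2 inf_le_right)
    · rw [h.map_sup, hx, Finset.insert_union,
        Finset.union_eq_right.2 (h.subset_iff.2 inf_le_right)]
  -- The first element of `φ ((x ⊔ y) ⊓ z)` outside `φ (x ⊓ z)` lies in `φ x` or `φ y`. Adding it to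
  -- `φ (x ⊓ z)` gives an element below `z` and below that one of `x`, `y`, hence below their common
  -- meet with `z`.
  · by_contra hne
    have hle : x ⊓ z ≤ (x ⊔ y) ⊓ z := inf_le_inf_right _ le_sup_left
    have hn : ¬ (x ⊔ y) ⊓ z ≤ x ⊓ z := fun h' => hne (le_antisymm h' hle)
    obtain ⟨e, he, he', -, c, hc, hac, hcy⟩ := h.exists_first hn
    rw [sup_eq_right.2 hle] at hcy
    have hexy : e ∈ φ x ∪ φ y := h.map_sup x y ▸ h.subset_iff.2 inf_le_left he
    have hcz : c ≤ z := hcy.trans inf_le_right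
    have key : ∀ w : L, x ⊓ z = w ⊓ z → e ∈ φ w → False := fun w hw hew => by
      refine hac.lt.not_ge (hw ▸ le_inf (h.subset_iff.1 ?_) hcz)
      rw [hc]
      exact Finset.insert_subset hew (h.subset_iff.2 (hw ▸ inf_le_left))
    exact (Finset.mem_union.1 hexy).elim (key x rfl) (key y hxyz)

end Extension

section CoverLabels

variable {L β : Type*} [Lattice L] [DecidableEq β] {le : β → β → Prop} {φ : L → Finset β}

open Classical in
/-- The elements that can be added to the feasible set `φ x`. -/
noncomputable def coverLabels [OrderTop L] (φ : L → Finset β) (x : L) : Finset β :=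
  {e ∈ φ ⊤ | e ∉ φ x ∧ ∃ c, φ c = insert e (φ x)}

lemma coverLabels_subset_top [OrderTop L] (φ : L → Finset β) (x : L) : coverLabels φ x ⊆ φ ⊤ := by
  classical
  exact Finset.filter_subset _ _

lemma mem_coverLabels [OrderTop L] (h : IsSupersolvableRep le φ) {x : L} {e : β} :
    e ∈ coverLabels φ x ↔ e ∉ φ x ∧ ∃ c, φ c = insert e (φ x) := by
  classical
  refine Finset.mem_filter.trans (and_iff_right_of_imp ?_)
  rintro ⟨-, c, hc⟩
  exact h.subset_iff.2 le_top (hc ▸ Finset.mem_insert_self _ _)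

open Classical in
/-- The largest `x` for which `φ x` is disjoint from `A`. -/
noncomputable def largestDisjoint [Fintype L] [OrderBot L] (φ : L → Finset β) (A : Finset β) : L :=
  (Finset.univ.filter fun x => Disjoint (φ x) A).sup id

lemma le_largestDisjoint_iff [Fintype L] [OrderBot L] (h : IsSupersolvableRep le φ) {x : L}
    {A : Finset β} : x ≤ largestDisjoint φ A ↔ Disjoint (φ x) A := by
  classical
  have hd : Disjoint (φ (largestDisjoint φ A)) A := by
    refine Finset.sup_induction (p := fun x => Disjoint (φ x) A) ?_ ?_ ?_
    · rw [h.map_bot]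
      exact Finset.disjoint_empty_left _
    · intro x hx y hy
      rw [h.map_sup]
      exact Finset.disjoint_union_left.2 ⟨hx, hy⟩
    · intro x hx
      exact (Finset.mem_filter.1 hx).2
  refine ⟨fun hx => hd.mono_left (h.subset_iff.2 hx), fun hx => ?_⟩
  exact Finset.le_sup (f := id) (Finset.mem_filter.2 ⟨Finset.mem_univ x, hx⟩)

end CoverLabels

end IsSupersolvableRep

/-! ### The matroid of a matroidal representation -/

namespace IsSupersolvableRep

section CoveringRank

variable {L β γ : Type*} [Lattice L] [BoundedOrder L] [DecidableEq β] [LinearOrder γ]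
  {ρ : β → γ} {φ : L → Finset β}

lemma card_coverLabels (h : IsSupersolvableRep (fun a b => ρ a ≤ ρ b) φ) (x : L) :
    (coverLabels φ x).card = coveringRank x := by
  rw [← Set.ncard_coe_finset, coveringRank]
  refine Set.ncard_congr (fun e he => (h.mem_coverLabels.1 (Finset.mem_coe.1 he)).2.choose) ?_ ?_ ?_
  · intro e he
    exact h.covBy_of_insert (h.mem_coverLabels.1 he).1 (h.mem_coverLabels.1 he).2.choose_spec
  · intro e f he hf hef
    have he' := (h.mem_coverLabels.1 he).2.choose_spec
    have hf' := (h.mem_coverLabels.1 hf).2.choose_spec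
    have hef' : insert e (φ x) = insert f (φ x) := he'.symm.trans ((congrArg φ hef).trans hf')
    exact (Finset.mem_insert.1 (hef' ▸ Finset.mem_insert_self e (φ x))).resolve_right
      (h.mem_coverLabels.1 he).1
  · intro y hy
    obtain ⟨e, he, hye⟩ := h.covBy_iff.1 hy
    have hmem := h.mem_coverLabels.2 ⟨he, y, hye⟩
    exact ⟨e, hmem, h.injective ((h.mem_coverLabels.1 hmem).2.choose_spec.trans hye.symm)⟩

variable [Fintype L]

/-- The first element of any larger feasible set outside `φ x` is itself a cover label of `x`, so no
larger set avoids the cover labels. -/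
lemma largestDisjoint_coverLabels (h : IsSupersolvableRep (fun a b => ρ a ≤ ρ b) φ) (x : L) :
    largestDisjoint φ (coverLabels φ x) = x := by
  have hle : x ≤ largestDisjoint φ (coverLabels φ x) := by
    rw [h.le_largestDisjoint_iff, Finset.disjoint_right]
    exact fun e he => (h.mem_coverLabels.1 he).1
  by_contra hne
  obtain ⟨e, he, he', -, c, hc, -, -⟩ := h.exists_first (fun hh => hne (le_antisymm hh hle))
  exact Finset.disjoint_left.1 (h.le_largestDisjoint_iff.1 le_rfl) he
    (h.mem_coverLabels.2 ⟨he', c, hc⟩)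

lemma coverLabels_largestDisjoint_subset (h : IsSupersolvableRep (fun a b => ρ a ≤ ρ b) φ)
    (A : Finset β) : coverLabels φ (largestDisjoint φ A) ⊆ A := by
  intro e he
  obtain ⟨he, c, hc⟩ := h.mem_coverLabels.1 he
  by_contra heA
  refine (h.covBy_of_insert he hc).lt.not_ge (h.le_largestDisjoint_iff.2 ?_)
  rw [hc, Finset.disjoint_insert_left]
  exact ⟨heA, h.le_largestDisjoint_iff.1 le_rfl⟩

/-- The rank of the closed set spanned by `A`. -/
noncomputable def hullRank (φ : L → Finset β) (A : Finset β) : ℕ :=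
  coveringRank (largestDisjoint φ A)

lemma hullRank_le_card (h : IsSupersolvableRep (fun a b => ρ a ≤ ρ b) φ) (A : Finset β) :
    hullRank φ A ≤ A.card := by
  rw [hullRank, ← h.card_coverLabels]
  exact Finset.card_le_card (h.coverLabels_largestDisjoint_subset A)

lemma hullRank_eq_card_iff (h : IsSupersolvableRep (fun a b => ρ a ≤ ρ b) φ) {A : Finset β} :
    hullRank φ A = A.card ↔ coverLabels φ (largestDisjoint φ A) = A := by
  rw [hullRank, ← h.card_coverLabels]
  refine ⟨fun hh => ?_, fun hh => by rw [hh]⟩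
  exact Finset.eq_of_subset_of_card_le (h.coverLabels_largestDisjoint_subset A) hh.ge

lemma largestDisjoint_antitone (h : IsSupersolvableRep (fun a b => ρ a ≤ ρ b) φ) {A B : Finset β}
    (hAB : A ⊆ B) : largestDisjoint φ B ≤ largestDisjoint φ A :=
  h.le_largestDisjoint_iff.2 ((h.le_largestDisjoint_iff.1 le_rfl).mono_right hAB)

lemma hullRank_mono (h : IsSupersolvableRep (fun a b => ρ a ≤ ρ b) φ) (hL : IsMatroidalLattice L)
    {A B : Finset β} (hAB : A ⊆ B) : hullRank φ A ≤ hullRank φ B :=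
  hL.1 (h.largestDisjoint_antitone hAB)

/-- `largestDisjoint` turns unions into meets. For intersections it only dominates the join, and
antitonicity of the covering rank makes up for this. -/
lemma hullRank_submodular (h : IsSupersolvableRep (fun a b => ρ a ≤ ρ b) φ)
    (hL : IsMatroidalLattice L) (A B : Finset β) :
    hullRank φ (A ∪ B) + hullRank φ (A ∩ B) ≤ hullRank φ A + hullRank φ B := by
  have hU : largestDisjoint φ (A ∪ B) = largestDisjoint φ A ⊓ largestDisjoint φ B :=
    eq_of_forall_le_iff fun x => by
      rw [le_inf_iff, h.le_largestDisjoint_iff, h.le_largestDisjoint_iff, h.le_largestDisjoint_iff,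
        Finset.disjoint_union_right]
  have hI : hullRank φ (A ∩ B) ≤ coveringRank (largestDisjoint φ A ⊔ largestDisjoint φ B) :=
    hL.1 (sup_le (h.largestDisjoint_antitone Finset.inter_subset_left)
      (h.largestDisjoint_antitone Finset.inter_subset_right))
  have := hL.2 (largestDisjoint φ A) (largestDisjoint φ B)
  simp only [hullRank] at hI ⊢
  rw [hU]
  omega

lemma hullRank_subset (h : IsSupersolvableRep (fun a b => ρ a ≤ ρ b) φ)
    (hL : IsMatroidalLattice L) {I J : Finset β} (hJ : hullRank φ J = J.card) (hIJ : I ⊆ J) :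
    hullRank φ I = I.card := by
  have h1 := h.hullRank_submodular hL I (J \ I)
  rw [Finset.union_sdiff_of_subset hIJ] at h1
  have h2 := h.hullRank_le_card (J \ I)
  have h3 := Finset.card_sdiff_add_card_eq_card hIJ
  have h4 := h.hullRank_le_card I
  omega

lemma hullRank_augment (h : IsSupersolvableRep (fun a b => ρ a ≤ ρ b) φ)
    (hL : IsMatroidalLattice L) {I J : Finset β} (hI : hullRank φ I = I.card)
    (hJ : hullRank φ J = J.card) (hIJ : I.card < J.card) :
    ∃ e ∈ J, e ∉ I ∧ hullRank φ (insert e I) = (insert e I).card := by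
  by_contra! hcon
  have hins : ∀ e ∈ J, hullRank φ (insert e I) ≤ I.card := by
    intro e he
    by_cases heI : e ∈ I
    · rw [Finset.insert_eq_of_mem heI, hI]
    · have h1 := hcon e he heI
      have h2 := h.hullRank_le_card (insert e I)
      rw [Finset.card_insert_of_notMem heI] at h1 h2
      omega
  -- If no single element of `J` raises the rank of `I`, submodularity shows that no set of them
  -- does.
  have key : ∀ S : Finset β, S ⊆ J → hullRank φ (I ∪ S) ≤ I.card := by
    intro S
    induction S using Finset.induction_on with
    | empty => intro _; rw [Finset.union_empty, hI]
    | insert e S _ ih =>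
      intro hS
      have h1 := h.hullRank_submodular hL (I ∪ S) (insert e I)
      have h2 := h.hullRank_mono hL (A := I) (B := (I ∪ S) ∩ insert e I)
        (Finset.subset_inter Finset.subset_union_left (Finset.subset_insert _ _))
      have h3 : I ∪ S ∪ insert e I = I ∪ insert e S := by grind
      have h4 := ih ((Finset.subset_insert _ _).trans hS)
      have h5 := hins e (hS (Finset.mem_insert_self _ _))
      rw [h3] at h1
      omega
  have h1 := key J subset_rfl
  have h2 := h.hullRank_mono hL (A := J) (B := I ∪ J) Finset.subset_union_right
  omega

/-- The matroid of a matroidal supersolvable representation: `I` is independent if and only if it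
is the set of labels of the covers of some lattice element. -/
noncomputable def toMatroid (h : IsSupersolvableRep (fun a b => ρ a ≤ ρ b) φ)
    (hL : IsMatroidalLattice L) : Matroid β :=
  (IndepMatroid.ofFinset (φ ⊤ : Set β) (fun I => hullRank φ I = I.card)
    ((h.hullRank_le_card ∅).antisymm (by simp))
    (fun _ _ hJ hIJ => h.hullRank_subset hL hJ hIJ)
    (fun _ _ hI hJ hIJ => h.hullRank_augment hL hI hJ hIJ)
    (fun I hI => by
      rw [Finset.coe_subset, ← h.hullRank_eq_card_iff.1 hI]
      exact coverLabels_subset_top φ _)).matroid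

lemma toMatroid_ground (h : IsSupersolvableRep (fun a b => ρ a ≤ ρ b) φ)
    (hL : IsMatroidalLattice L) : (h.toMatroid hL).E = φ ⊤ := rfl

lemma toMatroid_finite (h : IsSupersolvableRep (fun a b => ρ a ≤ ρ b) φ)
    (hL : IsMatroidalLattice L) : (h.toMatroid hL).Finite :=
  ⟨(φ ⊤).finite_toSet⟩

lemma toMatroid_indep (h : IsSupersolvableRep (fun a b => ρ a ≤ ρ b) φ)
    (hL : IsMatroidalLattice L) {I : Finset β} :
    (h.toMatroid hL).Indep I ↔ coverLabels φ (largestDisjoint φ I) = I := by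
  rw [← h.hullRank_eq_card_iff, toMatroid, IndepMatroid.matroid_indep_iff,
    IndepMatroid.ofFinset_indep]

lemma toMatroid_indep_coverLabels (h : IsSupersolvableRep (fun a b => ρ a ≤ ρ b) φ)
    (hL : IsMatroidalLattice L) (x : L) : (h.toMatroid hL).Indep (coverLabels φ x) := by
  rw [h.toMatroid_indep, h.largestDisjoint_coverLabels]

/-- An element of the feasible set complementary to the hull of `J` that precedes all elements of
the independent set `J` extends `J`. -/
lemma toMatroid_indep_insert (h : IsSupersolvableRep (fun a b => ρ a ≤ ρ b) φ)
    (hL : IsMatroidalLattice L) {J : Finset β} {e : β} (hJ : (h.toMatroid hL).Indep J)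
    (he : e ∈ φ (largestDisjoint φ J)) (hlt : ∀ z ∈ J, ρ z ≤ ρ e) :
    (h.toMatroid hL).Indep (insert e J : Finset β) := by
  rw [h.toMatroid_indep] at hJ ⊢
  set t := largestDisjoint φ J with ht
  set s := largestDisjoint φ (insert e J) with hs
  have hst : s ≤ t := h.largestDisjoint_antitone (Finset.subset_insert _ _)
  have hsd : Disjoint (φ s) (insert e J) := h.le_largestDisjoint_iff.1 le_rfl
  have htd : Disjoint (φ t) J := h.le_largestDisjoint_iff.1 le_rfl
  have hes : e ∉ φ s := fun hh => Finset.disjoint_left.1 hsd hh (Finset.mem_insert_self _ _)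
  have hsub : coverLabels φ s ⊆ insert e J := h.coverLabels_largestDisjoint_subset _
  -- The first element of `φ t \ φ s` is a cover label of `s`, hence in `insert e J`; as `φ t`
  -- avoids `J`, it is `e`.
  have hfirst : ∀ f ∈ φ t, f ∉ φ s → ρ e ≤ ρ f := by
    obtain ⟨w, hw, hw', hmin, c, hc, -, -⟩ :=
      h.exists_first (a := s) (b := t) fun hts => hes (h.subset_iff.2 hts he)
    have hwe : w = e := (Finset.mem_insert.1 (hsub (h.mem_coverLabels.2 ⟨hw', c, hc⟩))).resolve_right
      (Finset.disjoint_left.1 htd hw)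
    exact hwe ▸ hmin
  refine hsub.antisymm (Finset.insert_subset ?_ fun z hz => ?_)
  · exact h.mem_coverLabels.2 ⟨hes, h.exists_insert he hes hfirst⟩
  · have hzs : z ∉ φ s := fun hh => Finset.disjoint_left.1 hsd hh (Finset.mem_insert_of_mem hz)
    obtain ⟨-, c, hc⟩ := h.mem_coverLabels.1 (hJ.symm ▸ hz : z ∈ coverLabels φ t)
    -- Since `φ c` is `φ t` with `z` added and `z` does not come after `e`, it is a first element of
    -- `φ c \ φ s`.
    refine h.mem_coverLabels.2 ⟨hzs, h.exists_insert (b := c) (hc ▸ Finset.mem_insert_self _ _) hzs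
      fun f hf hfs => ?_⟩
    rw [hc, Finset.mem_insert] at hf
    obtain rfl | hf := hf
    · exact le_rfl
    · exact (hlt z hz).trans (hfirst f hf hfs)

end CoveringRank

/-! ### Recovering the lattice as the external order of its matroid -/

section ExternalOrder

variable {L α : Type*} [Lattice L] [Fintype L] [BoundedOrder L] [LinearOrder α] {φ : L → Finset α}

lemma extPassive_coverLabels
    (h : IsSupersolvableRep (fun a b => OrderDual.toDual a ≤ OrderDual.toDual b) φ)
    (hL : IsMatroidalLattice L) (x : L) :
    (h.toMatroid hL).extPassive (coverLabels φ x) = φ x := by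
  -- A feasible set cannot meet a circuit in its minimum alone: the rest of the circuit is
  -- independent, and `toMatroid_indep_insert` would make the whole circuit independent.
  have key : ∀ (C : Set α) (z : α) (c : L), (h.toMatroid hL).IsCircuit C → z ∈ C →
      (∀ y ∈ C, z ≤ y) → z ∈ φ c → (∀ y ∈ C, y ≠ z → y ∉ φ c) → False := by
    intro C z c hC hzC hmin hzc hdis
    have hfin : C.Finite := (φ ⊤).finite_toSet.subset hC.subset_ground
    set J : Finset α := hfin.toFinset.erase z with hJ
    have hJC : (J : Set α) = C \ {z} := by ext; simp [hJ, and_comm]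
    have hind : (h.toMatroid hL).Indep J := hJC ▸ hC.sdiff_singleton_indep hzC
    have hle : c ≤ largestDisjoint φ J := by
      rw [h.le_largestDisjoint_iff, Finset.disjoint_right]
      intro y hy
      have : y ∈ C \ {z} := hJC ▸ Finset.mem_coe.2 hy
      exact hdis y this.1 this.2
    have hins := h.toMatroid_indep_insert hL hind (h.subset_iff.2 hle hzc) fun y hy => by
      have : y ∈ C \ {z} := hJC ▸ Finset.mem_coe.2 hy
      exact hmin y this.1
    rw [Finset.coe_insert, hJC, Set.insert_sdiff_singleton, Set.insert_eq_of_mem hzC] at hins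
    exact hC.not_indep hins
  have hI := h.toMatroid_indep_coverLabels hL x
  ext e
  simp only [Matroid.extPassive, Matroid.extActive, Matroid.activeSet, Set.mem_sdiff,
    Set.mem_ofPred_eq, toMatroid_ground, Finset.mem_coe]
  constructor
  · rintro ⟨⟨heE, heI⟩, hna⟩
    by_contra hex
    refine hna ⟨?_, heI⟩
    have hdep : (h.toMatroid hL).Dep (insert e (coverLabels φ x) : Finset α) := by
      refine ⟨fun hind => ?_, ?_⟩
      · rw [h.toMatroid_indep] at hind
        have : largestDisjoint φ (insert e (coverLabels φ x)) = x := by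
          refine le_antisymm ?_ (h.le_largestDisjoint_iff.2 ?_)
          · refine (h.largestDisjoint_antitone (Finset.subset_insert _ _)).trans
              (h.largestDisjoint_coverLabels x).le
          · rw [Finset.disjoint_insert_right, Finset.disjoint_right]
            exact ⟨hex, fun y hy => (h.mem_coverLabels.1 hy).1⟩
        rw [this] at hind
        exact heI (hind.symm ▸ Finset.mem_insert_self _ _)
      · rw [toMatroid_ground, Finset.coe_subset]
        exact Finset.insert_subset heE (coverLabels_subset_top φ _)
    obtain ⟨C, hCs, hC⟩ := hdep.exists_isCircuit_subset
    rw [Finset.coe_insert] at hCs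
    have hfin : C.Finite := (φ ⊤).finite_toSet.subset hC.subset_ground
    obtain ⟨z, hz, hmin⟩ := Set.exists_min_image C id hfin hC.nonempty
    obtain rfl | hne := eq_or_ne z e
    · exact ⟨C, hC, hz, hCs, hmin⟩
    -- If the minimum `z` of the circuit is not `e`, it is a cover label of `x`, and the set of the
    -- corresponding cover meets the circuit only in `z`.
    · exfalso
      have hzI : z ∈ coverLabels φ x := (Set.mem_insert_iff.1 (hCs hz)).resolve_left hne
      obtain ⟨hzx, c, hc⟩ := h.mem_coverLabels.1 hzI
      refine key C z c hC hz hmin (hc ▸ Finset.mem_insert_self _ _) fun y hy hyz => ?_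
      rw [hc, Finset.mem_insert, not_or]
      refine ⟨hyz, ?_⟩
      obtain rfl | hy' := Set.mem_insert_iff.1 (hCs hy)
      · exact hex
      · exact (h.mem_coverLabels.1 hy').1
  · intro he
    refine ⟨⟨h.subset_iff.2 le_top he, fun heI => (h.mem_coverLabels.1 heI).1 he⟩, ?_⟩
    rintro ⟨⟨C, hC, heC, hCs, hmin⟩, -⟩
    refine key C e x hC heC hmin he fun y hy hye => ?_
    exact (h.mem_coverLabels.1 ((Set.mem_insert_iff.1 (hCs hy)).resolve_left hye)).1

/-- The represented lattice is the generalized external order of its matroid. -/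
noncomputable def orderIsoExternalOrder
    (h : IsSupersolvableRep (fun a b => OrderDual.toDual a ≤ OrderDual.toDual b) φ)
    (hL : IsMatroidalLattice L) : L ≃o (h.toMatroid hL).ExternalOrder where
  toFun x := ⟨coverLabels φ x, h.toMatroid_indep_coverLabels hL x⟩
  invFun I := largestDisjoint φ ((φ ⊤).finite_toSet.subset I.2.subset_ground).toFinset
  left_inv x := by simp [h.largestDisjoint_coverLabels]
  right_inv I := by
    refine Subtype.ext ?_
    have hI := I.2
    rw [← ((φ ⊤).finite_toSet.subset I.2.subset_ground).coe_toFinset, h.toMatroid_indep] at hI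
    simp only [hI, Set.Finite.coe_toFinset]
  map_rel_iff' {x y} := by
    change (h.toMatroid hL).extPassive (coverLabels φ x) ⊆
      (h.toMatroid hL).extPassive (coverLabels φ y) ↔ x ≤ y
    rw [h.extPassive_coverLabels, h.extPassive_coverLabels, Finset.coe_subset, h.subset_iff]

end ExternalOrder

end IsSupersolvableRep

/-! ### The feasible sets of an ordered matroid -/

namespace Matroid

section Feasible

variable {α : Type*} [LinearOrder α] {M : Matroid α} {A F G : Set α} {x : α}

lemma mem_activeSet_iff : x ∈ M.activeSet A ↔ x ∈ M.closure (A ∩ Set.Ioi x) := by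
  rw [mem_closure_iff_exists_isCircuit (fun h => lt_irrefl x h.2)]
  constructor
  · rintro ⟨C, hC, hxC, hCA, hmin⟩
    refine ⟨C, fun y hy => ?_, hC, hxC⟩
    obtain rfl | hne := eq_or_ne y x
    · exact Set.mem_insert _ _
    · exact Set.mem_insert_of_mem _ ⟨(hCA hy).resolve_left hne, lt_of_le_of_ne (hmin y hy) hne.symm⟩
  · rintro ⟨C, hCA, hC, hxC⟩
    refine ⟨C, hC, hxC, hCA.trans (Set.insert_subset_insert Set.inter_subset_left), fun y hy => ?_⟩
    exact (Set.mem_insert_iff.1 (hCA hy)).elim (fun h => h.ge) fun h => h.2.le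

lemma mem_extPassive_iff :
    x ∈ M.extPassive A ↔ x ∈ M.E ∧ x ∉ A ∧ x ∉ M.closure (A ∩ Set.Ioi x) := by
  rw [extPassive, extActive, Set.mem_sdiff, Set.mem_sdiff, Set.mem_sdiff, mem_activeSet_iff]
  tauto

/-- The complement of `F` contains every element that is active with respect to it. -/
def IsFeasible (M : Matroid α) (F : Set α) : Prop :=
  F ⊆ M.E ∧ ∀ x ∈ F, x ∉ M.closure ((M.E \ F) ∩ Set.Ioi x)

/-- An element outside `EP(A)` and above `x` is in `A` or spanned by still larger elements of `A`;
so if such elements span `x`, then `A ∩ Set.Ioi x` already does. -/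
lemma isFeasible_extPassive (hA : A ⊆ M.E) : M.IsFeasible (M.extPassive A) := by
  refine ⟨fun x hx => (mem_extPassive_iff.1 hx).1, fun x hx hcl => (mem_extPassive_iff.1 hx).2.2 ?_⟩
  refine M.closure_subset_closure_of_subset_closure (fun y hy => ?_) hcl
  obtain ⟨⟨hyE, hyF⟩, hxy⟩ := hy
  rw [mem_extPassive_iff, not_and, not_and, not_not] at hyF
  by_cases hyA : y ∈ A
  · exact M.mem_closure_of_mem ⟨hyA, hxy⟩ (Set.inter_subset_left.trans hA)
  · refine M.closure_subset_closure ?_ (hyF hyE hyA)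
    exact Set.inter_subset_inter_right _ (Set.Ioi_subset_Ioi (le_of_lt hxy))

lemma compl_extPassive_subset_closure (hA : A ⊆ M.E) :
    M.E \ M.extPassive A ⊆ M.closure A := by
  rintro y ⟨hyE, hyF⟩
  rw [mem_extPassive_iff, not_and, not_and, not_not] at hyF
  by_cases hyA : y ∈ A
  · exact M.mem_closure_of_mem hyA hA
  · exact M.closure_subset_closure Set.inter_subset_left (hyF hyE hyA)

lemma isFeasible_empty : M.IsFeasible ∅ := ⟨Set.empty_subset _, fun _ h => h.elim⟩

lemma IsFeasible.union (hF : M.IsFeasible F) (hG : M.IsFeasible G) : M.IsFeasible (F ∪ G) := by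
  refine ⟨Set.union_subset hF.1 hG.1, fun x hx hcl => ?_⟩
  obtain hx | hx := hx
  · exact hF.2 x hx (M.closure_subset_closure (by gcongr; exact Set.subset_union_left) hcl)
  · exact hG.2 x hx (M.closure_subset_closure (by gcongr; exact Set.subset_union_right) hcl)

lemma IsFeasible.insert_iff (hF : M.IsFeasible F) (hx : x ∈ M.E) :
    M.IsFeasible (insert x F) ↔ x ∉ M.closure ((M.E \ F) ∩ Set.Ioi x) := by
  have heq : (M.E \ insert x F) ∩ Set.Ioi x = (M.E \ F) ∩ Set.Ioi x := by
    ext y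
    simp only [Set.mem_inter_iff, Set.mem_sdiff, Set.mem_insert_iff, Set.mem_Ioi]
    constructor
    · tauto
    · rintro ⟨⟨h1, h2⟩, h3⟩
      exact ⟨⟨h1, not_or.2 ⟨h3.ne', h2⟩⟩, h3⟩
  constructor
  · intro h
    rw [← heq]
    exact h.2 x (Set.mem_insert _ _)
  · refine fun h => ⟨Set.insert_subset hx hF.1, fun y hy => ?_⟩
    obtain rfl | hy := hy
    · rwa [heq]
    · refine fun hcl => hF.2 y hy (M.closure_subset_closure ?_ hcl)
      gcongr
      exact Set.subset_insert _ _

/-- The lexicographically greatest basis of `A`. -/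
def greedyBasis (M : Matroid α) (A : Set α) : Set α :=
  {y ∈ A | y ∉ M.closure (A ∩ Set.Ioi y)}

lemma greedyBasis_subset : M.greedyBasis A ⊆ A := fun _ h => h.1

/-- The minimum of a circuit is spanned by the rest, which consists of larger elements, so the
greedy choice rejects it. -/
lemma greedyBasis_indep [M.Finite] (hA : A ⊆ M.E) : M.Indep (M.greedyBasis A) := by
  rw [indep_iff_forall_subset_not_isCircuit (greedyBasis_subset.trans hA)]
  intro C hCA hC
  obtain ⟨z, hz, hmin⟩ := Set.exists_min_image C id (M.set_finite C hC.subset_ground) hC.nonempty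
  refine (hCA hz).2 (M.closure_subset_closure ?_ (hC.mem_closure_sdiff_singleton_of_mem hz))
  exact fun y hy => ⟨greedyBasis_subset (hCA hy.1), lt_of_le_of_ne (hmin y hy.1) (Ne.symm hy.2)⟩

lemma closure_greedyBasis_inter_Ioi [M.Finite] (hA : A ⊆ M.E) (x : α) :
    M.closure (M.greedyBasis A ∩ Set.Ioi x) = M.closure (A ∩ Set.Ioi x) := by
  refine (M.closure_subset_closure (by gcongr; exact greedyBasis_subset)).antisymm
    (M.closure_subset_closure_of_subset_closure ?_)
  rintro y ⟨hyA, hxy⟩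
  -- Induction runs from the largest element of `A` downwards.
  refine ((M.set_finite A hA).wellFoundedOn (r := (· > ·))).induction
    (P := fun y => y ∈ Set.Ioi x → y ∈ M.closure (M.greedyBasis A ∩ Set.Ioi x)) hyA
    (fun y hy ih hxy => ?_) hxy
  by_cases hyB : y ∈ M.greedyBasis A
  · exact M.mem_closure_of_mem ⟨hyB, hxy⟩
      (Set.inter_subset_left.trans (greedyBasis_subset.trans hA))
  · have : y ∈ M.closure (A ∩ Set.Ioi y) := by
      by_contra h
      exact hyB ⟨hy, h⟩
    exact M.closure_subset_closure_of_subset_closure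
      (fun z hz => ih z hz.1 hz.2 (lt_trans hxy hz.2)) this

lemma greedyBasis_isBasis [M.Finite] (hA : A ⊆ M.E) : M.IsBasis (M.greedyBasis A) A := by
  refine (greedyBasis_indep hA).isBasis_of_subset_of_subset_closure greedyBasis_subset
    fun y hy => ?_
  by_cases hyB : y ∈ M.greedyBasis A
  · exact M.mem_closure_of_mem hyB (greedyBasis_subset.trans hA)
  · have : y ∈ M.closure (A ∩ Set.Ioi y) := by
      by_contra h
      exact hyB ⟨hy, h⟩
    rw [← closure_greedyBasis_inter_Ioi hA] at this
    exact M.closure_subset_closure Set.inter_subset_left this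

lemma IsFeasible.extPassive_greedyBasis [M.Finite] (hF : M.IsFeasible F) :
    M.extPassive (M.greedyBasis (M.E \ F)) = F := by
  ext x
  rw [mem_extPassive_iff, closure_greedyBasis_inter_Ioi Set.sdiff_subset]
  constructor
  · rintro ⟨hxE, hxB, hcl⟩
    by_contra hxF
    exact hxB ⟨⟨hxE, hxF⟩, hcl⟩
  · exact fun hx => ⟨hF.1 hx, fun h => h.1.2 hx, hF.2 x hx⟩

end Feasible

/-! ### The representation by externally passive sets and its covering ranks -/

section OrderIso

variable {L α : Type*} [Lattice L] [LinearOrder α] {M : Matroid α} [M.Finite]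

/-- The externally passive set of the independent set corresponding to a lattice element. -/
noncomputable def passiveRep (f : L ≃o M.ExternalOrder) (x : L) : Finset α :=
  (M.set_finite (M.extPassive (f x).1) fun _ h => (mem_extPassive_iff.1 h).1).toFinset

lemma coe_passiveRep (f : L ≃o M.ExternalOrder) (x : L) :
    (passiveRep f x : Set α) = M.extPassive (f x).1 := by
  simp [passiveRep]

lemma isFeasible_passiveRep (f : L ≃o M.ExternalOrder) (x : L) :
    M.IsFeasible (passiveRep f x) := by
  rw [coe_passiveRep]
  exact isFeasible_extPassive (f x).2.subset_ground

lemma passiveRep_subset_iff (f : L ≃o M.ExternalOrder) {x y : L} :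
    passiveRep f x ⊆ passiveRep f y ↔ x ≤ y := by
  rw [← f.le_iff_le, ← Finset.coe_subset, coe_passiveRep, coe_passiveRep]
  rfl

lemma IsFeasible.exists_passiveRep_eq (f : L ≃o M.ExternalOrder) {F : Set α}
    (hF : M.IsFeasible F) : ∃ x, (passiveRep f x : Set α) = F := by
  let I : M.ExternalOrder := ⟨M.greedyBasis (M.E \ F), greedyBasis_indep Set.sdiff_subset⟩
  refine ⟨f.symm I, ?_⟩
  rw [coe_passiveRep, f.apply_symm_apply]
  exact hF.extPassive_greedyBasis

lemma isSupersolvableRep_passiveRep (f : L ≃o M.ExternalOrder) :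
    IsSupersolvableRep (fun a b => OrderDual.toDual a ≤ OrderDual.toDual b) (passiveRep f) where
  subset_iff := passiveRep_subset_iff f
  map_sup x y := by
    obtain ⟨z, hz⟩ :=
      ((isFeasible_passiveRep f x).union (isFeasible_passiveRep f y)).exists_passiveRep_eq f
    rw [← Finset.coe_union, Finset.coe_inj] at hz
    refine subset_antisymm ?_ (Finset.union_subset ((passiveRep_subset_iff f).2 le_sup_left)
      ((passiveRep_subset_iff f).2 le_sup_right))
    rw [← hz, passiveRep_subset_iff]
    refine sup_le ((passiveRep_subset_iff f).1 ?_) ((passiveRep_subset_iff f).1 ?_) <;> rw [hz]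
    exacts [Finset.subset_union_left, Finset.subset_union_right]
  exists_empty := by
    obtain ⟨z, hz⟩ := (isFeasible_empty (M := M)).exists_passiveRep_eq f
    exact ⟨z, Finset.coe_eq_empty.1 hz⟩
  exists_insert {a b e} heb hea hmax := by
    have hF := isFeasible_passiveRep f a
    have hG := isFeasible_passiveRep f b
    have heE : e ∈ M.E := hG.1 heb
    have hins : M.IsFeasible (insert e (passiveRep f a : Set α)) := by
      rw [hF.insert_iff heE]
      -- As `e` is the largest element of `φ b \ φ a`, everything above `e` outside `φ a` is also
      -- outside `φ b`, so feasibility of `φ b` applies.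
      refine fun hcl => hG.2 e heb (M.closure_subset_closure ?_ hcl)
      rintro y ⟨⟨hyE, hya⟩, hey⟩
      refine ⟨⟨hyE, fun hyb => ?_⟩, hey⟩
      exact (lt_irrefl e) (lt_of_lt_of_le hey (hmax y hyb hya))
    obtain ⟨c, hc⟩ := hins.exists_passiveRep_eq f
    exact ⟨c, by rwa [← Finset.coe_insert, Finset.coe_inj] at hc⟩

lemma coe_coverLabels_passiveRep [BoundedOrder L] (f : L ≃o M.ExternalOrder) (x : L) :
    (IsSupersolvableRep.coverLabels (passiveRep f) x : Set α) =
      M.greedyBasis (M.E \ passiveRep f x) := by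
  have hF := isFeasible_passiveRep f x
  ext e
  rw [Finset.mem_coe, (isSupersolvableRep_passiveRep f).mem_coverLabels]
  constructor
  · rintro ⟨hex, c, hc⟩
    have hfc := isFeasible_passiveRep f c
    rw [hc, Finset.coe_insert] at hfc
    have heE : e ∈ M.E := hfc.1 (Set.mem_insert _ _)
    exact ⟨⟨heE, hex⟩, (hF.insert_iff heE).1 hfc⟩
  · rintro ⟨⟨heE, hex⟩, hcl⟩
    obtain ⟨c, hc⟩ := ((hF.insert_iff heE).2 hcl).exists_passiveRep_eq f
    exact ⟨hex, c, by rwa [← Finset.coe_insert, Finset.coe_inj] at hc⟩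

lemma coveringRank_eq_eRk [BoundedOrder L] (f : L ≃o M.ExternalOrder) (x : L) :
    (coveringRank x : ℕ∞) = M.eRk (M.E \ passiveRep f x) := by
  rw [← (isSupersolvableRep_passiveRep f).card_coverLabels, ← Set.encard_coe_eq_coe_finsetCard,
    coe_coverLabels_passiveRep, (greedyBasis_isBasis Set.sdiff_subset).encard_eq_eRk]

/-- The generalized external order is matroidal. -/
lemma isMatroidalLattice_of_orderIso [BoundedOrder L] (f : L ≃o M.ExternalOrder) :
    IsMatroidalLattice L := by
  constructor
  · intro x y hxy
    rw [← ENat.natCast_le_natCast, coveringRank_eq_eRk f, coveringRank_eq_eRk f]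
    refine M.eRk_mono (Set.sdiff_subset_sdiff_right ?_)
    exact Finset.coe_subset.2 ((passiveRep_subset_iff f).2 hxy)
  · intro x y
    rw [← ENat.natCast_le_natCast, ENat.natCast_add, ENat.natCast_add, coveringRank_eq_eRk f,
      coveringRank_eq_eRk f, coveringRank_eq_eRk f, coveringRank_eq_eRk f]
    set φ := passiveRep f with hφ
    -- The intersection `φ x ∩ φ y` need not be feasible. The passive set of its complement is
    -- feasible and contained in it, and the elements outside that set are all spanned by this
    -- complement. This bounds the rank at `x ⊓ y`.
    have hA : M.E \ (φ x ∩ φ y) ⊆ M.E := Set.sdiff_subset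
    obtain ⟨z, hz⟩ := (isFeasible_extPassive hA).exists_passiveRep_eq f
    have hz' : (φ z : Set α) ⊆ φ x ∩ φ y := by
      rw [hφ, hz]
      intro e he
      obtain ⟨heE, he, -⟩ := mem_extPassive_iff.1 he
      by_contra hn
      exact he ⟨heE, hn⟩
    have hzxy : z ≤ x ⊓ y :=
      le_inf ((passiveRep_subset_iff f).1 (Finset.coe_subset.1 (hz'.trans Set.inter_subset_left)))
        ((passiveRep_subset_iff f).1 (Finset.coe_subset.1 (hz'.trans Set.inter_subset_right)))
    have h1 : M.eRk (M.E \ φ (x ⊓ y)) ≤ M.eRk (M.E \ (φ x ∩ φ y)) := by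
      rw [← M.eRk_closure_eq (M.E \ (φ x ∩ φ y))]
      refine M.eRk_mono (Set.Subset.trans ?_ (compl_extPassive_subset_closure hA))
      rw [← hz]
      exact Set.sdiff_subset_sdiff_right (Finset.coe_subset.2 ((passiveRep_subset_iff f).2 hzxy))
    rw [hφ, (isSupersolvableRep_passiveRep f).map_sup, Finset.coe_union, add_comm]
    exact le_trans (add_le_add_right h1 _) (M.eRk_compl_union_add_eRk_compl_inter_le _ _)

end OrderIso

end Matroid

/-! ### Unrefinable chains -/

section Chains

variable {P : Type*} [PartialOrder P] {x y : P} {m : List P}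

lemma isUnrefinableChain_singleton (x : P) : IsUnrefinableChain x x [x] := by
  simp [IsUnrefinableChain]

lemma IsUnrefinableChain.cons {b : P} (hxb : x ⋖ b) (hm : IsUnrefinableChain b y m) :
    IsUnrefinableChain x y (x :: m) := by
  obtain ⟨h1, h2, h3⟩ := hm
  obtain _ | ⟨c, m⟩ := m
  · simp at h2
  · simp only [List.head?_cons, Option.some.injEq] at h2
    subst h2
    exact ⟨List.isChain_cons_cons.2 ⟨hxb, h1⟩, rfl, by rwa [List.getLast?_cons_cons]⟩

lemma IsUnrefinableChain.cases (hm : IsUnrefinableChain x y m) :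
    (x = y ∧ m = [x]) ∨ ∃ b m', x ⋖ b ∧ IsUnrefinableChain b y m' ∧ m = x :: m' := by
  obtain ⟨h1, h2, h3⟩ := hm
  match m, h1, h2, h3 with
  | [a], _, h2, h3 =>
    simp only [List.head?_cons, Option.some.injEq, List.getLast?_singleton] at h2 h3
    exact Or.inl ⟨h2.symm.trans h3, by rw [h2]⟩
  | a :: b :: m, h1, h2, h3 =>
    simp only [List.head?_cons, Option.some.injEq] at h2
    subst h2
    rw [List.isChain_cons_cons] at h1
    rw [List.getLast?_cons_cons] at h3
    exact Or.inr ⟨b, b :: m, h1.1, ⟨h1.2, rfl, h3⟩, rfl⟩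

/-- Induction along an unrefinable chain, starting from its last element. -/
lemma IsUnrefinableChain.induct {motive : P → List P → Prop} (hm : IsUnrefinableChain x y m)
    (base : motive y [y])
    (step : ∀ x b m, x ⋖ b → IsUnrefinableChain b y m → motive b m → motive x (x :: m)) :
    motive x m := by
  induction m generalizing x with
  | nil => simp [IsUnrefinableChain] at hm
  | cons a m ih =>
    obtain ⟨rfl, h⟩ | ⟨b, m', hxb, hb, h⟩ := hm.cases
    · rw [h]
      exact base
    · obtain ⟨rfl, rfl⟩ := List.cons_eq_cons.1 h
      exact step _ _ _ hxb hb (ih hb)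

lemma IsUnrefinableChain.le (hm : IsUnrefinableChain x y m) : x ≤ y :=
  hm.induct (motive := fun x _ => x ≤ y) le_rfl fun _ _ _ hxb _ h => hxb.le.trans h

lemma IsUnrefinableChain.eq_singleton (hm : IsUnrefinableChain x x m) : m = [x] := by
  obtain ⟨-, h⟩ | ⟨b, m', hxb, hb, -⟩ := hm.cases
  · exact h
  · exact (hxb.lt.not_ge hb.le).elim

lemma labelSeq_cons {b : P} (lab : P → P → ℤ) (hm : IsUnrefinableChain b y m) (x : P) :
    labelSeq lab (x :: m) = lab x b :: labelSeq lab m := by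
  obtain ⟨-, h2, -⟩ := hm
  obtain _ | ⟨c, m⟩ := m
  · simp at h2
  · simp only [List.head?_cons, Option.some.injEq] at h2
    subst h2
    rfl

/-- The list `1, …, n` in the definition of `S_n` EL-shellability. -/
lemma label_list_eq (n : ℕ) :
    (((List.range n).map fun i => (i : ℤ) + 1) : List ℤ) =
      List.map (fun i : ℕ => (i : ℤ) + 1) (List.range n) := by
  -- On the left the cast to `ℤ` acts on the whole list through the monad coercion, so it unfolds to
  -- a `flatMap`.
  rw [List.bind_eq_flatMap, List.map_flatMap, List.map_eq_flatMap]
  rfl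

lemma exists_isUnrefinableChain [Finite P] (hxy : x ≤ y) : ∃ m, IsUnrefinableChain x y m := by
  induction x using WellFoundedGT.induction with
  | ind x ih =>
    obtain rfl | hlt := eq_or_lt_of_le hxy
    · exact ⟨_, isUnrefinableChain_singleton _⟩
    · obtain ⟨b, hxb, hby⟩ := exists_covBy_le_of_lt hlt
      obtain ⟨m, hm⟩ := ih b hxb.lt hby
      exact ⟨_, hm.cons hxb⟩

end Chains

/-! ### From representations to EL-labelings and supersolvability -/

namespace IsSupersolvableRep

section Transport

variable {L β γ δ ε : Type*} [Lattice L] [OrderTop L] [DecidableEq β] [LinearOrder γ]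
  [DecidableEq δ] [LinearOrder ε] {ρ : β → γ} {φ : L → Finset β}

/-- Transporting a supersolvable representation by an order preserving injection. -/
lemma transport (h : IsSupersolvableRep (fun a b => ρ a ≤ ρ b) φ) (σ : β → δ) (τ : δ → ε)
    (hσ : Set.InjOn σ (φ ⊤))
    (hστ : ∀ e ∈ φ ⊤, ∀ f ∈ φ ⊤, τ (σ e) ≤ τ (σ f) → ρ e ≤ ρ f) :
    IsSupersolvableRep (fun a b => τ a ≤ τ b) (fun x => (φ x).image σ) := by
  have hsub : ∀ x, φ x ⊆ φ ⊤ := fun x => h.subset_iff.2 le_top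
  have hmem : ∀ {x e}, e ∈ φ ⊤ → (σ e ∈ (φ x).image σ ↔ e ∈ φ x) := by
    refine fun {x e} he => ⟨fun hh => ?_, Finset.mem_image_of_mem σ⟩
    obtain ⟨f, hf, hfe⟩ := Finset.mem_image.1 hh
    exact hσ (hsub x hf) he hfe ▸ hf
  refine ⟨fun {x y} => ?_, fun x y => ?_, ?_, fun {a b e} heb hea hmin => ?_⟩
  · rw [← h.subset_iff]
    refine ⟨fun hh e he => ?_, Finset.image_subset_image⟩
    exact (hmem (hsub x he)).1 (hh (Finset.mem_image_of_mem σ he))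
  · rw [h.map_sup, Finset.image_union]
  · obtain ⟨x, hx⟩ := h.exists_empty
    exact ⟨x, by rw [hx, Finset.image_empty]⟩
  · obtain ⟨e, he, rfl⟩ := Finset.mem_image.1 heb
    rw [hmem (hsub b he)] at hea
    obtain ⟨c, hc⟩ := h.exists_insert he hea fun f hf hfa =>
      hστ e (hsub b he) f (hsub b hf)
        (hmin (σ f) (Finset.mem_image_of_mem σ hf) fun hh => hfa ((hmem (hsub b hf)).1 hh))
    exact ⟨c, by rw [hc, Finset.image_insert]⟩

/-- Every supersolvable representation can be transported to an initial segment of `ℕ`. -/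
lemma exists_normalized (h : IsSupersolvableRep (fun a b => ρ a ≤ ρ b) φ)
    -- Injectivity of `ρ` makes the position of an element in `φ ⊤` a faithful renumbering.
    (hρ : Function.Injective ρ) :
    ∃ (n : ℕ) (ψ : L → Finset ℕ), IsSupersolvableRep (fun a b => id a ≤ id b) ψ ∧
      ψ ⊤ = Finset.range n := by
  let σ : β → ℕ := fun e => ((φ ⊤).filter fun f => ρ f < ρ e).card
  have hlt : ∀ e ∈ φ ⊤, ∀ f, ρ e < ρ f → σ e < σ f := by
    intro e he f hef
    refine Finset.card_lt_card (Finset.ssubset_iff_subset_ne.2 ⟨fun g hg => ?_, fun heq => ?_⟩)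
    · exact Finset.mem_filter.2 ⟨(Finset.mem_filter.1 hg).1, (Finset.mem_filter.1 hg).2.trans hef⟩
    · exact lt_irrefl _ (Finset.mem_filter.1 (heq ▸ Finset.mem_filter.2 ⟨he, hef⟩ :
        e ∈ (φ ⊤).filter fun f => ρ f < ρ e)).2
  have hinj : Set.InjOn σ (φ ⊤) := by
    intro e he f hf hef
    by_contra hne
    obtain h' | h' := lt_or_gt_of_ne (hρ.ne hne)
    · exact (hlt e he f h').ne hef
    · exact (hlt f hf e h').ne' hef
  refine ⟨(φ ⊤).card, fun x => (φ x).image σ, h.transport σ id hinj fun e he f hf hef => ?_, ?_⟩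
  · by_contra hfe
    exact (hlt f hf e (not_le.1 hfe)).not_ge hef
  · refine Finset.eq_of_subset_of_card_le (fun k hk => ?_) ?_
    · obtain ⟨e, he, rfl⟩ := Finset.mem_image.1 hk
      refine Finset.mem_range.2 (Finset.card_lt_card (Finset.filter_ssubset.2 ⟨e, he, ?_⟩))
      exact lt_irrefl _
    · rw [Finset.card_range, Finset.card_image_of_injOn hinj]

end Transport

section Normalized

variable {L : Type*} {φ : L → Finset ℕ}

/-- The label of a cover `x ⋖ y` is the successor of the unique element of `φ y \ φ x`. -/
def coverLabel (φ : L → Finset ℕ) (x y : L) : ℤ := ((∑ e ∈ φ y \ φ x, e : ℕ) : ℤ) + 1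

lemma coverLabel_eq {x y : L} {e : ℕ} (he : e ∉ φ x) (hy : φ y = insert e (φ x)) :
    coverLabel φ x y = e + 1 := by
  rw [coverLabel, hy, Finset.insert_sdiff_of_notMem _ he, Finset.sdiff_self, insert_empty_eq,
    Finset.sum_singleton]

variable [Lattice L]

lemma labelSeq_coverLabel (h : IsSupersolvableRep (fun a b => id a ≤ id b) φ) {x y : L}
    {m : List L} (hm : IsUnrefinableChain x y m) :
    m.length = (φ y \ φ x).card + 1 ∧ (labelSeq (coverLabel φ) m).Nodup ∧
      ∀ l, l ∈ labelSeq (coverLabel φ) m ↔ ∃ e ∈ φ y, e ∉ φ x ∧ l = (e : ℤ) + 1 := by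
  refine hm.induct (motive := fun x m => m.length = (φ y \ φ x).card + 1 ∧
    (labelSeq (coverLabel φ) m).Nodup ∧
      ∀ l, l ∈ labelSeq (coverLabel φ) m ↔ ∃ e ∈ φ y, e ∉ φ x ∧ l = (e : ℤ) + 1) ?_ ?_
  · refine ⟨by simp, by simp [labelSeq], fun l => ?_⟩
    simp only [labelSeq, List.tail_cons, List.zipWith_nil_right, List.not_mem_nil, false_iff]
    rintro ⟨e, he, he', -⟩
    exact he' he
  · rintro x b m hxb hb ⟨h1, h2, h3⟩
    obtain ⟨e, he, hbe⟩ := h.covBy_iff.1 hxb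
    have hey : e ∈ φ y := h.subset_iff.2 hb.le (hbe ▸ Finset.mem_insert_self _ _)
    rw [labelSeq_cons _ hb, coverLabel_eq he hbe]
    refine ⟨?_, List.nodup_cons.2 ⟨fun hmem => ?_, h2⟩, fun l => ?_⟩
    · have : φ y \ φ x = insert e (φ y \ φ b) := by
        ext f
        simp only [hbe, Finset.mem_sdiff, Finset.mem_insert]
        by_cases hfe : f = e
        · simp [hfe, hey, he]
        · simp [hfe]
      rw [List.length_cons, h1, this, Finset.card_insert_of_notMem (by simp [hbe])]
    · obtain ⟨f, -, hf, hfe⟩ := (h3 _).1 hmem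
      have : e = f := by omega
      exact hf (this ▸ hbe ▸ Finset.mem_insert_self _ _)
    · rw [List.mem_cons, h3]
      constructor
      · rintro (rfl | ⟨f, hf, hfb, rfl⟩)
        · exact ⟨e, hey, he, rfl⟩
        · exact ⟨f, hf, fun hfx => hfb (hbe ▸ Finset.mem_insert_of_mem hfx), rfl⟩
      · rintro ⟨f, hf, hfx, rfl⟩
        by_cases hfe : f = e
        · exact Or.inl (by rw [hfe])
        · exact Or.inr ⟨f, hf, by simp [hbe, hfe, hfx], rfl⟩

/-- Always adding the least missing element `e` gives the increasing chain. A chain that departs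
from it uses a larger label there and must add `e` later, so it is lexicographically greater and has
a descent. -/
lemma isELLabeling_coverLabel [Finite L] (h : IsSupersolvableRep (fun a b => id a ≤ id b) φ) :
    IsELLabeling (coverLabel φ) := by
  intro x y hxy
  induction x using WellFoundedGT.induction with
  | ind x ih =>
    obtain rfl | hlt := eq_or_lt_of_le hxy
    · exact ⟨[x], isUnrefinableChain_singleton x, by simp [labelSeq],
        fun m hm hne => (hne hm.eq_singleton).elim⟩
    obtain ⟨e, hey, hex, hmin, c, hc, hxc, hcy⟩ := h.exists_first hlt.not_ge
    rw [sup_eq_right.2 hxy] at hcy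
    obtain ⟨m₀, hm₀, hinc, huniq⟩ := ih c hxc.lt hcy
    refine ⟨x :: m₀, hm₀.cons hxc, ?_, fun m hm hne => ?_⟩
    · rw [labelSeq_cons _ hm₀, coverLabel_eq hex hc, List.pairwise_cons]
      refine ⟨fun l hl => ?_, hinc⟩
      obtain ⟨f, hf, hfc, rfl⟩ := ((h.labelSeq_coverLabel hm₀).2.2 l).1 hl
      have := hmin f hf fun hfx => hfc (hc ▸ Finset.mem_insert_of_mem hfx)
      simp only [id] at this
      omega
    · obtain ⟨rfl, -⟩ | ⟨b, m', hxb, hb, rfl⟩ := hm.cases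
      · exact (lt_irrefl _ hlt).elim
      rw [labelSeq_cons _ hm₀, coverLabel_eq hex hc, labelSeq_cons _ hb]
      obtain ⟨f, hfx, hbf⟩ := h.covBy_iff.1 hxb
      rw [coverLabel_eq hfx hbf]
      by_cases hfe : f = e
      · have hbc : b = c := h.injective (by rw [hbf, hc, hfe])
        subst hbc hfe
        obtain ⟨h1, h2⟩ := huniq m' hb fun heq => hne (by rw [heq])
        exact ⟨fun hp => h1 (List.pairwise_cons.1 hp).2, List.cons_lt_cons_self.2 h2⟩
      · have hef : e ≤ f := hmin f (h.subset_iff.2 hb.le (hbf ▸ Finset.mem_insert_self _ _)) hfx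
        refine ⟨fun hp => ?_, List.Lex.rel (by omega)⟩
        have := (List.pairwise_cons.1 hp).1 ((e : ℤ) + 1)
          (((h.labelSeq_coverLabel hb).2.2 _).2 ⟨e, hey, by simp [hbf, hex, Ne.symm hfe], rfl⟩)
        omega

/-- A lattice with a normalized supersolvable representation is `S_n` EL-shellable. -/
lemma isSnELShellable [Finite L] [BoundedOrder L]
    (h : IsSupersolvableRep (fun a b => id a ≤ id b) φ) {n : ℕ} (hn : φ ⊤ = Finset.range n) :
    IsSnELShellable L := by
  have hmax : ∀ m : List L, IsMaximalChainList m → IsUnrefinableChain ⊥ ⊤ m := by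
    rintro m ⟨x, y, hx, hy, hm⟩
    rwa [hx.eq_bot, hy.eq_top] at hm
  refine ⟨n, fun m hm => ?_, coverLabel φ, h.isELLabeling_coverLabel, fun m hm => ?_⟩
  · rw [(h.labelSeq_coverLabel (hmax m hm)).1, h.map_bot, hn]
    simp
  · obtain ⟨-, h2, h3⟩ := h.labelSeq_coverLabel (hmax m hm)
    rw [label_list_eq]
    refine (List.perm_ext_iff_of_nodup h2 (List.nodup_range.map fun a b hab => ?_)).2 fun l => ?_
    · simpa using hab
    · rw [h3, h.map_bot, hn]
      simp [eq_comm]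

/-- Elements of `φ y` can be added to `∅` in increasing order, so truncations are feasible. Hence
meets with initial segments are intersections. -/
lemma exists_eq_inter_range (h : IsSupersolvableRep (fun a b => id a ≤ id b) φ) (y : L) (t : ℕ) :
    ∃ z, φ z = φ y ∩ Finset.range t := by
  induction t with
  | zero =>
    obtain ⟨x, hx⟩ := h.exists_empty
    exact ⟨x, by simp [hx]⟩
  | succ t ih =>
    obtain ⟨z, hz⟩ := ih
    by_cases hty : t ∈ φ y
    · obtain ⟨c, hc⟩ := h.exists_insert (a := z) (b := y) hty (by simp [hz]) fun f hf hfz => by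
        by_contra hlt
        exact hfz (hz ▸ Finset.mem_inter.2 ⟨hf, Finset.mem_range.2 (not_le.1 hlt)⟩)
      exact ⟨c, by rw [hc, hz, Finset.range_add_one, Finset.inter_insert_of_mem hty]⟩
    · exact ⟨z, by rw [hz, Finset.range_add_one, Finset.inter_insert_of_notMem hty]⟩

lemma map_inf_of_eq_range (h : IsSupersolvableRep (fun a b => id a ≤ id b) φ) {d : L} {t : ℕ}
    (hd : φ d = Finset.range t) (y : L) : φ (d ⊓ y) = φ d ∩ φ y := by
  refine subset_antisymm (Finset.subset_inter (h.subset_iff.2 inf_le_left)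
    (h.subset_iff.2 inf_le_right)) ?_
  obtain ⟨z, hz⟩ := h.exists_eq_inter_range y t
  rw [Finset.inter_comm, hd, ← hz]
  refine h.subset_iff.2 (le_inf (h.subset_iff.1 ?_) (h.subset_iff.1 ?_)) <;> rw [hz]
  · exact hd ▸ Finset.inter_subset_right
  · exact Finset.inter_subset_left

/-- A lattice with a normalized supersolvable representation is supersolvable. -/
lemma isSupersolvable [BoundedOrder L]
    (h : IsSupersolvableRep (fun a b => id a ≤ id b) φ) {n : ℕ} (hn : φ ⊤ = Finset.range n) :
    IsSupersolvable L := by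
  let D : Set L := {x | ∃ t, φ x = Finset.range t}
  have hDchain : IsChain (· ≤ ·) D := by
    rintro x ⟨s, hs⟩ y ⟨t, ht⟩ -
    obtain hst | hst := le_total s t
    · exact Or.inl (h.subset_iff.1 (by rw [hs, ht]; exact Finset.range_mono hst))
    · exact Or.inr (h.subset_iff.1 (by rw [hs, ht]; exact Finset.range_mono hst))
  have hinf : ∀ {K : Set L}, IsChain (· ≤ ·) K → ∀ a ∈ K, ∀ b ∈ K, a ⊓ b ∈ K := by
    intro K hK a ha b hb
    obtain hab | hab := hK.total ha hb
    · rwa [inf_eq_left.2 hab]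
    · rwa [inf_eq_right.2 hab]
  have htop : ⊤ ∈ D := ⟨n, hn⟩
  refine ⟨D, ⟨hDchain, fun D' hD' hDD' => hDD'.antisymm fun z hz => ?_⟩, fun K hK => ?_⟩
  · obtain ⟨d, hd⟩ := h.exists_eq_inter_range ⊤ (φ z).card
    have hzn : (φ z).card ≤ n := by
      simpa [hn] using Finset.card_le_card (h.subset_iff.2 (le_top : z ≤ ⊤))
    -- Maximality: `z` is comparable with the member `d` of the chain whose set has the same
    -- cardinality, so the two sets agree.
    rw [hn, Finset.inter_eq_right.2 (Finset.range_mono hzn)] at hd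
    refine ⟨(φ z).card, ?_⟩
    have hdD : d ∈ D := ⟨_, hd⟩
    rw [← hd]
    obtain hzd | hdz := hD'.total hz (hDD' hdD)
    · exact Finset.eq_of_subset_of_card_le (h.subset_iff.2 hzd) (by simp [hd])
    · exact (Finset.eq_of_subset_of_card_le (h.subset_iff.2 hdz) (by simp [hd])).symm
  · set K' : Set L := insert ⊤ K
    have hK' : IsChain (· ≤ ·) K' := hK.insert fun b _ _ => Or.inr le_top
    -- These are the joins of elements `d ⊓ k`. They form a sublattice on which `φ` also turns meets
    -- into intersections, so distributivity is inherited from sets. Having `⊤` in `K'` puts `D`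
    -- inside `S`.
    let S : Set L := {z | ∀ e ∈ φ z, ∃ d ∈ D, ∃ k ∈ K', e ∈ φ (d ⊓ k) ∧ d ⊓ k ≤ z}
    have hSinf : ∀ a ∈ S, ∀ b ∈ S, ∀ e, e ∈ φ a → e ∈ φ b →
        ∃ d ∈ D, ∃ k ∈ K', e ∈ φ (d ⊓ k) ∧ d ⊓ k ≤ a ⊓ b := by
      intro a ha b hb e hea heb
      obtain ⟨d, ⟨s, hd⟩, k, hk, he, hle⟩ := ha e hea
      obtain ⟨d', ⟨s', hd'⟩, k', hk', he', hle'⟩ := hb e heb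
      rw [h.map_inf_of_eq_range hd, Finset.mem_inter] at he
      rw [h.map_inf_of_eq_range hd', Finset.mem_inter] at he'
      obtain ⟨t, ht⟩ := hinf hDchain d ⟨s, hd⟩ d' ⟨s', hd'⟩
      refine ⟨d ⊓ d', ⟨t, ht⟩, k ⊓ k', hinf hK' k hk k' hk', ?_, ?_⟩
      · rw [h.map_inf_of_eq_range ht, Finset.mem_inter, h.map_inf_of_eq_range hd,
          Finset.mem_inter]
        refine ⟨⟨he.1, he'.1⟩, ?_⟩
        obtain hkk | hkk := hK'.total hk hk'
        · rw [inf_eq_left.2 hkk]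
          exact he.2
        · rw [inf_eq_right.2 hkk]
          exact he'.2
      · exact le_inf ((inf_le_inf inf_le_left inf_le_left).trans hle)
          ((inf_le_inf inf_le_right inf_le_right).trans hle')
    have hS : IsSublattice S := by
      refine ⟨fun a ha b hb e he => ?_, fun a ha b hb e he => ?_⟩
      · rw [h.map_sup, Finset.mem_union] at he
        obtain he | he := he
        · obtain ⟨d, hd, k, hk, he, hle⟩ := ha e he
          exact ⟨d, hd, k, hk, he, hle.trans le_sup_left⟩
        · obtain ⟨d, hd, k, hk, he, hle⟩ := hb e he
          exact ⟨d, hd, k, hk, he, hle.trans le_sup_right⟩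
      · exact hSinf a ha b hb e (h.subset_iff.2 inf_le_left he) (h.subset_iff.2 inf_le_right he)
    have hmap : ∀ a ∈ S, ∀ b ∈ S, φ (a ⊓ b) = φ a ∩ φ b := by
      refine fun a ha b hb => subset_antisymm (Finset.subset_inter (h.subset_iff.2 inf_le_left)
        (h.subset_iff.2 inf_le_right)) fun e he => ?_
      rw [Finset.mem_inter] at he
      obtain ⟨d, -, k, -, hek, hle⟩ := hSinf a ha b hb e he.1 he.2
      exact h.subset_iff.2 hle hek
    have hsub : latticeClosure (D ∪ K) ⊆ S := by
      refine latticeClosure_min ?_ hS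
      rintro z (hz | hz) e he
      · exact ⟨z, hz, ⊤, Set.mem_insert _ _, by rwa [inf_top_eq], inf_le_left⟩
      · exact ⟨⊤, htop, z, Set.mem_insert_of_mem _ hz, by rwa [top_inf_eq], inf_le_right⟩
    intro a ha b hb c hc
    have ha := hsub ha
    have hb := hsub hb
    have hc := hsub hc
    apply h.injective
    rw [hmap a ha _ (hS.supClosed hb hc), h.map_sup, h.map_sup, hmap a ha b hb, hmap a ha c hc,
      Finset.inter_union_distrib_left]

end Normalized

end IsSupersolvableRep

/-! ### Representing join-distributive supersolvable lattices -/

section MeetIrreducibles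

variable {L : Type*} [Lattice L]

/-- By meet semidistributivity `y ≰ m ⊔ m'`. If `m` were strictly below `m ⊔ m'`, then
semimodularity gives `m ⋖ m ⊔ y` and `m = (m ⊔ y) ⊓ (m ⊔ m')`, contradicting irreducibility;
likewise for `m'`. So a cover has at most one irreducible as its label. -/
lemma IsJoinDistributive.infIrred_unique (hJ : IsJoinDistributive L) {x y m m' : L} (hxy : x ⋖ y)
    (hm : InfIrred m) (hm' : InfIrred m') (hxm : x ≤ m) (hxm' : x ≤ m') (hym : ¬ y ≤ m)
    (hym' : ¬ y ≤ m') : m = m' := by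
  have := hJ.1
  have hinf : ∀ {k}, x ≤ k → ¬ y ≤ k → k ⊓ y = x := by
    intro k hxk hyk
    refine (hxy.eq_or_eq (le_inf hxk hxy.le) inf_le_right).resolve_right fun h => hyk ?_
    exact h ▸ inf_le_left
  have hsup : (m ⊔ m') ⊓ y = x :=
    (hJ.2 m m' y ((hinf hxm hym).trans (hinf hxm' hym').symm)).trans (hinf hxm hym)
  have hy : ¬ y ≤ m ⊔ m' := fun h => hxy.lt.ne' (by rw [← hsup, inf_eq_right.2 h])
  have key : ∀ {k : L}, InfIrred k → x ≤ k → ¬ y ≤ k → k ≤ m ⊔ m' → k = m ⊔ m' := by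
    intro k hk hxk hyk hle
    have hcov : k ⋖ k ⊔ y := by
      have hc : y ⊓ k ⋖ y := by rwa [inf_comm, hinf hxk hyk]
      have := IsUpperModularLattice.covBy_sup_of_inf_covBy hc
      rwa [sup_comm] at this
    obtain h | h := hcov.eq_or_eq (le_inf le_sup_left hle : k ≤ (k ⊔ y) ⊓ (m ⊔ m')) inf_le_left
    · obtain h | h := hk.2 h
      · exact (hcov.lt.ne' h).elim
      · exact h.symm
    · exact (hy ((le_sup_right.trans h.ge).trans inf_le_right)).elim
  exact (key hm hxm hym le_sup_left).trans (key hm' hxm' hym' le_sup_right).symm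

variable [Fintype L]

open Classical in
/-- The meet-irreducible elements that are not above `x`. -/
noncomputable def irredRep (x : L) : Finset {m : L // InfIrred m} :=
  Finset.univ.filter fun m => ¬ x ≤ m

lemma mem_irredRep {x : L} {m : {m : L // InfIrred m}} : m ∈ irredRep x ↔ ¬ x ≤ m := by
  classical
  simp [irredRep]

lemma irredRep_subset_iff [OrderTop L] {x y : L} : irredRep x ⊆ irredRep y ↔ x ≤ y := by
  refine ⟨fun h => ?_, fun hxy m hm => ?_⟩
  · obtain ⟨s, hs, hirr⟩ := exists_infIrred_decomposition y
    rw [← hs]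
    refine Finset.le_inf fun m hm => ?_
    by_contra hxm
    refine mem_irredRep.1 (h (mem_irredRep.2 hxm : (⟨m, hirr hm⟩ : {m : L // InfIrred m}) ∈ _)) ?_
    exact hs ▸ Finset.inf_le (f := id) hm
  · exact mem_irredRep.2 fun hym => mem_irredRep.1 hm (hxy.trans hym)

end MeetIrreducibles

section MaxChain

variable {L : Type*} [Lattice L] [Finite L] [BoundedOrder L] {D : Set L}

lemma IsMaxChain.exists_covBy (hD : IsMaxChain (· ≤ ·) D) {d : L} (hd : d ∈ D) (hne : d ≠ ⊤) :
    ∃ d' ∈ D, d ⋖ d' := by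
  obtain ⟨d', ⟨hd', hdd'⟩, hmin⟩ := (Set.toFinite {c | c ∈ D ∧ d < c}).exists_minimal
    ⟨⊤, hD.top_mem, hne.lt_top⟩
  refine ⟨d', hd', hdd', fun z hdz hzd' => ?_⟩
  have hz : z ∈ D := by
    have hins : IsChain (· ≤ ·) (insert z D) := by
      refine hD.1.insert fun c hc _ => ?_
      by_cases hcd : c ≤ d
      · exact Or.inr (hcd.trans hdz.le)
      · have hdc : d < c := lt_of_le_not_ge ((hD.1.total hc hd).resolve_left hcd) hcd
        obtain h | h := hD.1.total hc hd'
        · exact Or.inl (hzd'.le.trans (hmin ⟨hc, hdc⟩ h))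
        · exact Or.inl (hzd'.le.trans h)
    rw [hD.2 hins (Set.subset_insert _ _)]
    exact Set.mem_insert _ _
  exact hzd'.not_ge (hmin ⟨hz, hdz⟩ hzd'.le)

/-- The place where a maximal chain leaves the lower set of `m`. -/
lemma IsMaxChain.exists_covBy_le (hD : IsMaxChain (· ≤ ·) D) {m : L} (hm : m ≠ ⊤) :
    ∃ d ∈ D, ∃ d' ∈ D, d ⋖ d' ∧ d ≤ m ∧ ¬ d' ≤ m := by
  obtain ⟨d, ⟨hd, hdm⟩, hmax⟩ := (Set.toFinite {c | c ∈ D ∧ c ≤ m}).exists_maximal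
    ⟨⊥, hD.bot_mem, bot_le⟩
  obtain ⟨d', hd', hcov⟩ := hD.exists_covBy hd fun h => hm (top_le_iff.1 (h ▸ hdm))
  exact ⟨d, hd, d', hd', hcov, hdm, fun h => hcov.lt.not_ge (hmax ⟨hd', h⟩ hcov.le)⟩

end MaxChain

section Supersolvable

variable {L : Type*} [Lattice L] [Fintype L] [BoundedOrder L] {D : Set L}

/-- If `D` is a maximal chain witnessing supersolvability, then meets with elements of `D` are
intersections in the representation by meet-irreducibles. -/
lemma IsJoinDistributive.mem_irredRep_inf (hJ : IsJoinDistributive L)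
    (hD : IsMaxChain (· ≤ ·) D)
    (hdist : ∀ K : Set L, IsChain (· ≤ ·) K → ∀ a ∈ latticeClosure (D ∪ K),
      ∀ b ∈ latticeClosure (D ∪ K), ∀ c ∈ latticeClosure (D ∪ K), a ⊓ (b ⊔ c) = (a ⊓ b) ⊔ (a ⊓ c))
    (b : L) {d : L} (hd : d ∈ D) {m : {m : L // InfIrred m}} (hmd : m ∈ irredRep d)
    (hmb : m ∈ irredRep b) : m ∈ irredRep (d ⊓ b) := by
  -- The induction descends along `D` from `⊤`, where the claim is trivial.
  induction d using WellFoundedGT.induction with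
  | ind d ih =>
    obtain rfl | hne := eq_or_ne d ⊤
    · rwa [top_inf_eq]
    obtain ⟨d', hd', hcov⟩ := hD.exists_covBy hd hne
    have hm' : m ∈ irredRep (d' ⊓ b) := ih d' hcov.lt hd' (irredRep_subset_iff.2 hcov.le hmd)
    by_cases hle : d' ⊓ b ≤ d
    · exact irredRep_subset_iff.2 (le_inf hle inf_le_right) hm'
    have hcov' : d ⊓ b ⋖ d' ⊓ b := by
      refine ⟨lt_of_le_not_ge (inf_le_inf_right _ hcov.le) fun h => hle (h.trans inf_le_left),
        fun u hu huv => huv.ne ?_⟩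
      -- For `u` strictly between, distributivity of the sublattice generated by `D` and `{u, v}`
      -- gives `v = v ⊓ (d ⊔ u) = (v ⊓ d) ⊔ (v ⊓ u) = u`.
      set v := d' ⊓ b with hv
      have hud : ¬ u ≤ d := fun h =>
        hu.not_ge (le_inf h (huv.le.trans inf_le_right))
      have hsup : d ⊔ u = d' :=
        (hcov.eq_or_eq le_sup_left (sup_le hcov.le (huv.le.trans inf_le_left))).resolve_left
          fun h => hud (sup_eq_left.1 h)
      have hchain : IsChain (· ≤ ·) ({u, v} : Set L) := IsChain.pair huv.le
      have := hdist {u, v} hchain v (subset_latticeClosure (by simp)) d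
        (subset_latticeClosure (Or.inl hd)) u (subset_latticeClosure (by simp))
      rw [hsup, inf_eq_left.2 (inf_le_left : v ≤ d'), inf_eq_right.2 huv.le] at this
      have hvd : v ⊓ d ≤ u := le_trans (le_inf inf_le_right (inf_le_left.trans inf_le_right)) hu.le
      rw [sup_eq_right.2 hvd] at this
      exact this.symm
    -- Some irreducible `k ≥ d` is not above `d' ⊓ b`. If `m` were above `d ⊓ b`, both would label
    -- the cover `d ⊓ b ⋖ d' ⊓ b`, forcing `m = k ≥ d`.
    obtain ⟨k, hk, hkd⟩ := Finset.not_subset.1 fun h => hle (irredRep_subset_iff.1 h)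
    rw [mem_irredRep, not_not] at hkd
    rw [mem_irredRep] at hk hm' hmd ⊢
    intro hdm
    have := hJ.infIrred_unique hcov' m.2 k.2 hdm (inf_le_left.trans hkd) hm' hk
    exact hmd (this ▸ hkd)

/-- A join-distributive supersolvable lattice has a supersolvable representation. -/
lemma IsJoinDistributive.exists_rep_of_isSupersolvable (hJ : IsJoinDistributive L)
    (hS : IsSupersolvable L) :
    ∃ (n : ℕ) (ψ : L → Finset ℕ), IsSupersolvableRep (fun a b => id a ≤ id b) ψ ∧
      ψ ⊤ = Finset.range n := by
  classical
  obtain ⟨D, hD, hdist⟩ := hS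
  let ρ : {m : L // InfIrred m} → ℕ := fun m => (Finset.univ.filter fun d => d ∈ D ∧ d ≤ m).card
  have hρ : ∀ {m m' : {m : L // InfIrred m}} {d : L}, d ∈ D → d ≤ m → ¬ d ≤ m' → ρ m' < ρ m := by
    intro m m' d hd hdm hdm'
    refine Finset.card_lt_card (Finset.ssubset_iff_subset_ne.2 ⟨fun c hc => ?_, fun heq => ?_⟩)
    · obtain ⟨-, hc, hcm'⟩ := Finset.mem_filter.1 hc
      refine Finset.mem_filter.2 ⟨Finset.mem_univ _, hc, le_trans ?_ hdm⟩
      exact (hD.1.total hc hd).resolve_right fun h => hdm' (h.trans hcm')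
    · have : d ∈ Finset.univ.filter fun d => d ∈ D ∧ d ≤ m' :=
        heq ▸ Finset.mem_filter.2 ⟨Finset.mem_univ _, hd, hdm⟩
      exact hdm' (Finset.mem_filter.1 this).2.2
  have hinj : Function.Injective ρ := by
    intro m m' hmm'
    obtain ⟨d, hd, d', hd', hcov, hdm, hdm'⟩ := hD.exists_covBy_le m.2.ne_top
    have h1 : d ≤ m' := by
      by_contra h
      exact (hρ hd hdm h).ne' hmm'
    have h2 : ¬ d' ≤ m' := fun h => (hρ hd' h hdm').ne hmm'
    exact Subtype.ext (hJ.infIrred_unique hcov m.2 m'.2 hdm h1 hdm' h2)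
  have hsup : ∀ x y : L, irredRep (x ⊔ y) = irredRep x ∪ irredRep y := by
    intro x y
    ext m
    rw [Finset.mem_union, mem_irredRep, mem_irredRep, mem_irredRep, sup_le_iff, not_and_or]
  have hrep : IsSupersolvableRep (fun a b => ρ a ≤ ρ b) (irredRep (L := L)) := by
    refine ⟨irredRep_subset_iff, hsup, ⟨⊥, ?_⟩, fun {a b e} heb hea hmin => ?_⟩
    · ext m
      simp [mem_irredRep]
    · obtain ⟨d, hd, d', hd', hcov, hde, hde'⟩ := hD.exists_covBy_le e.2.ne_top
      -- The chain leaves the lower set of `e` at `d ⋖ d'`. A new irreducible `f` is not above `d'`,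
      -- and minimality of `e` puts it above `d`, so uniqueness gives `f = e`.
      refine ⟨a ⊔ (d' ⊓ b), subset_antisymm (fun f hf => ?_) (Finset.insert_subset ?_ ?_)⟩
      · rw [hsup, Finset.mem_union] at hf
        by_contra hn
        rw [Finset.mem_insert, not_or] at hn
        have hf := hf.resolve_left hn.2
        have hfb := irredRep_subset_iff.2 inf_le_right hf
        have hfd' := irredRep_subset_iff.2 inf_le_left hf
        rw [mem_irredRep] at hfd'
        have hdf : d ≤ f := by
          by_contra h
          exact (hρ hd hde h).not_ge (hmin f hfb hn.2)
        exact hn.1 (Subtype.ext (hJ.infIrred_unique hcov f.2 e.2 hdf hde hfd' hde'))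
      · refine irredRep_subset_iff.2 le_sup_right ?_
        exact hJ.mem_irredRep_inf hD hdist b hd' (mem_irredRep.2 hde') heb
      · exact irredRep_subset_iff.2 le_sup_left
  exact hrep.exists_normalized hinj

end Supersolvable

/-! ### Representing join-distributive `S_n` EL-shellable lattices -/

section Concatenation

variable {P : Type*} [PartialOrder P] {x y z : P} {m m' : List P}

lemma IsUnrefinableChain.exists_append (lab : P → P → ℤ) (hm : IsUnrefinableChain x y m)
    (hm' : IsUnrefinableChain y z m') :
    ∃ k, IsUnrefinableChain x z k ∧ labelSeq lab k = labelSeq lab m ++ labelSeq lab m' := by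
  refine hm.induct (motive := fun x m => ∃ k, IsUnrefinableChain x z k ∧
    labelSeq lab k = labelSeq lab m ++ labelSeq lab m') ⟨m', hm', rfl⟩ ?_
  rintro x b m hxb hb ⟨k, hk, hlab⟩
  exact ⟨x :: k, hk.cons hxb, by rw [labelSeq_cons _ hk, labelSeq_cons _ hb, hlab,
    List.cons_append]⟩

lemma isUnrefinableChain_pair (hxy : x ⋖ y) : IsUnrefinableChain x y [x, y] :=
  (isUnrefinableChain_singleton y).cons hxy

lemma IsUnrefinableChain.eq_pair (hxy : x ⋖ y) (hm : IsUnrefinableChain x y m) : m = [x, y] := by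
  obtain ⟨rfl, -⟩ | ⟨b, m', hxb, hb, rfl⟩ := hm.cases
  · exact (lt_irrefl _ hxy.lt).elim
  · obtain rfl : b = y := by
      by_contra hne
      exact hxy.2 hxb.lt (lt_of_le_of_ne hb.le hne)
    rw [hb.eq_singleton]

end Concatenation

section LabelSets

variable {L : Type*} [Lattice L] [Finite L] [BoundedOrder L]

/-- The labels of the edges of a maximal chain of `[⊥, x]`. -/
noncomputable def labelSet (lab : L → L → ℤ) (x : L) : Finset ℤ :=
  (labelSeq lab (exists_isUnrefinableChain (bot_le : ⊥ ≤ x)).choose).toFinset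

variable {lab : L → L → ℤ} {R : List ℤ}

lemma labelSet_bot : labelSet lab (⊥ : L) = ∅ := by
  rw [labelSet, (exists_isUnrefinableChain (bot_le : ⊥ ≤ (⊥ : L))).choose_spec.eq_singleton]
  simp [labelSeq]

/-- Two chains from `⊥` to `x` continued by the same chain to `⊤` have label sequences that are
permutations of each other; cancelling the common tail shows that the label set does not depend on
the chain. -/
lemma toFinset_labelSeq
    (hperm : ∀ m : List L, IsUnrefinableChain ⊥ ⊤ m → (labelSeq lab m).Perm R)
    {x : L} {m : List L} (hm : IsUnrefinableChain ⊥ x m) :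
    (labelSeq lab m).toFinset = labelSet lab x := by
  obtain ⟨r, hr⟩ := exists_isUnrefinableChain (le_top : x ≤ ⊤)
  obtain ⟨k, hk, hlab⟩ := hm.exists_append lab hr
  obtain ⟨k', hk', hlab'⟩ :=
    (exists_isUnrefinableChain (bot_le : ⊥ ≤ x)).choose_spec.exists_append lab hr
  have hp := (hperm k hk).trans (hperm k' hk').symm
  rw [hlab, hlab', List.perm_append_right_iff] at hp
  exact List.toFinset_eq_of_perm _ _ hp

lemma labelSet_eq_union
    (hperm : ∀ m : List L, IsUnrefinableChain ⊥ ⊤ m → (labelSeq lab m).Perm R)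
    (hR : R.Nodup) {x y : L} {m : List L} (hm : IsUnrefinableChain x y m) :
    labelSet lab y = labelSet lab x ∪ (labelSeq lab m).toFinset ∧ (labelSeq lab m).Nodup ∧
      ∀ l ∈ labelSeq lab m, l ∉ labelSet lab x := by
  have hx := (exists_isUnrefinableChain (bot_le : ⊥ ≤ x)).choose_spec
  obtain ⟨r, hr⟩ := exists_isUnrefinableChain (le_top : y ≤ ⊤)
  obtain ⟨k, hk, hlab⟩ := hx.exists_append lab hm
  obtain ⟨k', hk', hlab'⟩ := hk.exists_append lab hr
  have hnd : (labelSeq lab k').Nodup := (hperm k' hk').nodup_iff.2 hR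
  rw [hlab'] at hnd
  have hnd' := hnd.of_append_left
  rw [← toFinset_labelSeq hperm hk, hlab, List.toFinset_append]
  rw [hlab, List.nodup_append'] at hnd'
  exact ⟨rfl, hnd'.2.1, fun l hl hl' => hnd'.2.2 (List.mem_toFinset.1 hl') hl⟩

lemma labelSet_covBy
    (hperm : ∀ m : List L, IsUnrefinableChain ⊥ ⊤ m → (labelSeq lab m).Perm R)
    (hR : R.Nodup) {x y : L} (hxy : x ⋖ y) :
    labelSet lab y = insert (lab x y) (labelSet lab x) ∧ lab x y ∉ labelSet lab x := by
  obtain ⟨h1, -, h3⟩ := labelSet_eq_union hperm hR (isUnrefinableChain_pair hxy)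
  refine ⟨?_, h3 _ (by simp [labelSeq])⟩
  rw [h1, Finset.union_comm]
  simp [labelSeq]

lemma labelSet_mono
    (hperm : ∀ m : List L, IsUnrefinableChain ⊥ ⊤ m → (labelSeq lab m).Perm R)
    (hR : R.Nodup) {x y : L} (hxy : x ≤ y) :
    labelSet lab x ⊆ labelSet lab y := by
  obtain ⟨m, hm⟩ := exists_isUnrefinableChain hxy
  rw [(labelSet_eq_union hperm hR hm).1]
  exact Finset.subset_union_left

/-- Opposite edges of a covering square carry the same label. -/
lemma IsJoinDistributive.label_square (hJ : IsJoinDistributive L)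
    (hperm : ∀ m : List L, IsUnrefinableChain ⊥ ⊤ m → (labelSeq lab m).Perm R) (hR : R.Nodup)
    (hEL : IsELLabeling lab) {w x y : L} (hx : w ⋖ x) (hy : w ⋖ y) (hne : x ≠ y) :
    x ⋖ x ⊔ y ∧ lab x (x ⊔ y) = lab w y := by
  have := hJ.1
  have hinf : ∀ {x y : L}, w ⋖ x → w ⋖ y → x ≠ y → x ⊓ y = w := by
    intro x y hx hy hne
    refine (hx.eq_or_eq (le_inf hx.le hy.le) inf_le_left).resolve_right fun h => ?_
    obtain h' | h' := hy.eq_or_eq hx.le (inf_eq_left.1 h)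
    · exact hx.lt.ne' h'
    · exact hne h'
  have hcov : ∀ {x y : L}, w ⋖ x → w ⋖ y → x ≠ y → x ⋖ x ⊔ y := by
    intro x y hx hy hne
    have hc : y ⊓ x ⋖ y := by rwa [hinf hy hx hne.symm]
    have := IsUpperModularLattice.covBy_sup_of_inf_covBy hc
    rwa [sup_comm] at this
  refine ⟨hcov hx hy hne, ?_⟩
  set j := x ⊔ y with hj
  have hxj : x ⋖ j := hcov hx hy hne
  have hyj : y ⋖ j := by
    have := hcov hy hx hne.symm
    rwa [sup_comm] at this
  obtain ⟨m₀, hm₀, hinc, huniq⟩ := hEL w j (hx.le.trans hxj.le)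
  obtain ⟨z, hz, hzj, hm₀⟩ : ∃ z, w ⋖ z ∧ z ≤ j ∧ ∀ _ : z ⋖ j, m₀ = [w, z, j] := by
    obtain ⟨h, -⟩ | ⟨z, m', hz, hm', rfl⟩ := hm₀.cases
    · exact ((hx.lt.trans hxj.lt).ne h).elim
    · exact ⟨z, hz, hm'.le, fun hzj => by rw [hm'.eq_pair hzj]⟩
  -- A third cover `z ≤ x ⊔ y` of `w` would meet both `x` and `y` in `w`, hence also `x ⊔ y`, by
  -- meet semidistributivity.
  have hzxy : z = x ∨ z = y := by
    by_contra! hn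
    have h1 := hJ.2 x y z ((hinf hx hz hn.1.symm).trans (hinf hy hz hn.2.symm).symm)
    rw [inf_eq_right.2 hzj, hinf hx hz hn.1.symm] at h1
    exact hz.lt.ne' h1
  -- Both sides of the square carry the same two labels, one side in increasing and the other in
  -- decreasing order, so opposite edges agree.
  have hlabels : ∀ {a b : L}, w ⋖ a → w ⋖ b → a ⋖ j → b ⋖ j → a ≠ b → m₀ = [w, a, j] →
      lab a j = lab w b ∧ lab b j = lab w a := by
    intro a b ha hb haj hbj hab hm
    have hle : lab w a ≤ lab a j := by
      rw [hm] at hinc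
      simpa [labelSeq] using hinc
    have hgt : lab b j < lab w b := by
      have := (huniq [w, b, j] ((isUnrefinableChain_pair hbj).cons hb)
        (by rw [hm]; simpa using hab.symm)).1
      simpa [labelSeq] using this
    obtain ⟨a1, a2⟩ := labelSet_covBy hperm hR ha
    obtain ⟨a3, a4⟩ := labelSet_covBy hperm hR haj
    obtain ⟨b1, b2⟩ := labelSet_covBy hperm hR hb
    obtain ⟨b3, b4⟩ := labelSet_covBy hperm hR hbj
    rw [a1] at a3 a4
    rw [b1] at b3 b4
    have hset := a3.symm.trans b3
    have e1 : lab w a ∈ insert (lab b j) (insert (lab w b) (labelSet lab w)) := hset ▸ by simp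
    have e2 : lab a j ∈ insert (lab b j) (insert (lab w b) (labelSet lab w)) := hset ▸ by simp
    simp only [Finset.mem_insert] at e1 e2 a4 b4
    grind
  obtain rfl | rfl := hzxy
  · exact (hlabels hx hy hxj hyj hne (hm₀ hxj)).1
  · exact (hlabels hy hx hyj hxj hne.symm (hm₀ hyj)).2

/-- The label of a cover is preserved under joins that do not absorb it. -/
lemma IsJoinDistributive.label_sup (hJ : IsJoinDistributive L)
    (hperm : ∀ m : List L, IsUnrefinableChain ⊥ ⊤ m → (labelSeq lab m).Perm R) (hR : R.Nodup)
    (hEL : IsELLabeling lab) {x y z : L} (hxy : x ⋖ y) (hxz : x ≤ z) (hyz : ¬ y ≤ z) :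
    z ⋖ z ⊔ y ∧ lab z (z ⊔ y) = lab x y := by
  induction x using WellFoundedGT.induction generalizing y with
  | ind x ih =>
    obtain rfl | hlt := eq_or_lt_of_le hxz
    · rw [sup_eq_right.2 hxy.le]
      exact ⟨hxy, rfl⟩
    · obtain ⟨b, hxb, hbz⟩ := exists_covBy_le_of_lt hlt
      obtain ⟨h1, h2⟩ := hJ.label_square hperm hR hEL hxb hxy fun h => hyz (h ▸ hbz)
      obtain ⟨h3, h4⟩ := ih b hxb.lt h1 hbz fun h => hyz (le_sup_right.trans h)
      rw [← sup_assoc, sup_eq_left.2 hbz] at h3 h4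
      exact ⟨h3, h4.trans h2⟩

/-- For a cover `u ⋖ y`, passing from `x ⊔ u` to `x ⊔ y` either changes nothing or adds the label of
`u ⋖ y`, by `label_sup`. -/
lemma IsJoinDistributive.labelSet_sup (hJ : IsJoinDistributive L)
    (hperm : ∀ m : List L, IsUnrefinableChain ⊥ ⊤ m → (labelSeq lab m).Perm R) (hR : R.Nodup)
    (hEL : IsELLabeling lab) (x y : L) :
    labelSet lab (x ⊔ y) = labelSet lab x ∪ labelSet lab y := by
  refine subset_antisymm ?_ (Finset.union_subset (labelSet_mono hperm hR le_sup_left)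
    (labelSet_mono hperm hR le_sup_right))
  induction y using WellFoundedLT.induction with
  | ind y ih =>
    obtain rfl | hlt := eq_or_ne y ⊥
    · rw [sup_bot_eq]
      exact Finset.subset_union_left
    · obtain ⟨u, -, huy⟩ := exists_le_covBy_of_lt hlt.bot_lt
      have hu := ih u huy.lt
      have hmono : labelSet lab x ∪ labelSet lab u ⊆ labelSet lab x ∪ labelSet lab y :=
        Finset.union_subset_union_right (labelSet_mono hperm hR huy.le)
      have hsup : x ⊔ u ⊔ y = x ⊔ y := by rw [sup_assoc, sup_eq_right.2 huy.le]
      by_cases hle : y ≤ x ⊔ u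
      · rw [← hsup, sup_eq_left.2 hle]
        exact hu.trans hmono
      · obtain ⟨h1, h2⟩ := hJ.label_sup hperm hR hEL huy le_sup_right hle
        rw [hsup] at h1 h2
        rw [(labelSet_covBy hperm hR h1).1, h2]
        refine Finset.insert_subset (Finset.mem_union_right _ ?_) (hu.trans hmono)
        rw [(labelSet_covBy hperm hR huy).1]
        exact Finset.mem_insert_self _ _

lemma IsJoinDistributive.isSupersolvableRep_labelSet (hJ : IsJoinDistributive L)
    (hperm : ∀ m : List L, IsUnrefinableChain ⊥ ⊤ m → (labelSeq lab m).Perm R) (hR : R.Nodup)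
    (hEL : IsELLabeling lab) :
    IsSupersolvableRep (fun a b => id a ≤ id b) (labelSet lab) := by
  have hsup := hJ.labelSet_sup hperm hR hEL
  refine ⟨fun {x y} => ⟨fun h => ?_, labelSet_mono hperm hR⟩, hsup, ⟨⊥, labelSet_bot⟩,
    fun {a b e} heb hea hmin => ?_⟩
  · by_contra hxy
    obtain ⟨b, hyb, hb⟩ := exists_covBy_le_of_lt (right_lt_sup.2 hxy)
    obtain ⟨h1, h2⟩ := labelSet_covBy hperm hR hyb
    have h3 := labelSet_mono hperm hR hb (h1 ▸ Finset.mem_insert_self _ _)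
    rw [hsup, Finset.union_eq_right.2 h] at h3
    exact h2 h3
  -- The increasing chain from `a` to `a ⊔ b` begins with its least label. All its labels lie in
  -- `labelSet lab b` outside `labelSet lab a`, so this label is `e`.
  · obtain ⟨m₀, hm₀, hinc, -⟩ := hEL a (a ⊔ b) le_sup_left
    obtain ⟨h1, -, h3⟩ := labelSet_eq_union hperm hR hm₀
    have he : e ∈ labelSeq lab m₀ := by
      have : e ∈ labelSet lab (a ⊔ b) := by
        rw [hsup]
        exact Finset.mem_union_right _ heb
      rw [h1, Finset.mem_union, List.mem_toFinset] at this
      exact this.resolve_left hea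
    obtain ⟨-, rfl⟩ | ⟨c, m', hac, hm', rfl⟩ := hm₀.cases
    · simp [labelSeq] at he
    · rw [labelSeq_cons _ hm'] at he hinc h3 h1
      obtain ⟨hc1, hc2⟩ := labelSet_covBy hperm hR hac
      refine ⟨c, ?_⟩
      have hmem : lab a c ∈ labelSet lab b := by
        have : lab a c ∈ labelSet lab (a ⊔ b) := by simp [h1]
        rw [hsup, Finset.mem_union] at this
        exact this.resolve_left hc2
      have hle : e ≤ lab a c := hmin _ hmem hc2
      have hge : lab a c ≤ e := by
        obtain rfl | he := List.mem_cons.1 he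
        · exact le_rfl
        · exact (List.pairwise_cons.1 hinc).1 e he
      rw [hc1, le_antisymm hle hge]

end LabelSets

/-- A join-distributive `S_n` EL-shellable lattice has a supersolvable representation. -/
lemma IsJoinDistributive.exists_rep_of_isSnELShellable {L : Type*} [Lattice L] [Finite L]
    [BoundedOrder L] (hJ : IsJoinDistributive L) (hS : IsSnELShellable L) :
    ∃ (n : ℕ) (ψ : L → Finset ℕ), IsSupersolvableRep (fun a b => id a ≤ id b) ψ ∧
      ψ ⊤ = Finset.range n := by
  obtain ⟨n, -, lab, hEL, hperm⟩ := hS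
  have hR : (List.map (fun i : ℕ => (i : ℤ) + 1) (List.range n)).Nodup :=
    List.nodup_range.map fun a b hab => by simpa using hab
  refine (hJ.isSupersolvableRep_labelSet (fun m hm => ?_) hR hEL).exists_normalized
    Function.injective_id
  rw [← label_list_eq]
  exact hperm m ⟨⊥, ⊤, isMin_bot, isMax_top, hm⟩

/-! ### The two equivalences -/

/-- A matroidal lattice with a normalized supersolvable representation is the generalized external
order of an ordered matroid on any linear order that contains a decreasing sequence. -/
lemma IsSupersolvableRep.exists_orderIso_externalOrder {L α : Type*} [Lattice L] [Fintype L]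
    [BoundedOrder L] [LinearOrder α] {ψ : L → Finset ℕ}
    (h : IsSupersolvableRep (fun a b => id a ≤ id b) ψ) (hL : IsMatroidalLattice L) {σ : ℕ → α}
    (hσ : StrictAnti σ) : ∃ M : Matroid α, M.Finite ∧ Nonempty (L ≃o M.ExternalOrder) := by
  have h' := h.transport σ OrderDual.toDual hσ.injective.injOn fun e _ f _ hef => hσ.le_iff_ge.1 hef
  exact ⟨h'.toMatroid hL, h'.toMatroid_finite hL, ⟨h'.orderIsoExternalOrder hL⟩⟩

theorem mainTheorem1 (L : Type u) [Lattice L] [Finite L] [Nonempty L] :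
    ((∃ (α : Type v) (_ : LinearOrder α) (M : Matroid α),
        M.Finite ∧ Nonempty (L ≃o M.ExternalOrder)) ↔
      IsJoinDistributive L ∧ IsMatroidalLattice L ∧ IsSnELShellable L) ∧
    ((∃ (α : Type v) (_ : LinearOrder α) (M : Matroid α),
        M.Finite ∧ Nonempty (L ≃o M.ExternalOrder)) ↔
      IsJoinDistributive L ∧ IsMatroidalLattice L ∧ IsSupersolvable L) := by
  cases nonempty_fintype L
  let _ : BoundedOrder L := Fintype.toBoundedOrder L
  -- The order is reversed because activity refers to minima of circuits while representations add
  -- the first element; `ULift` only adjusts the universe.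
  have hσ : StrictAnti fun k : ℕ => (ULift.up (OrderDual.toDual k) : ULift.{v} ℕᵒᵈ) :=
    fun _ _ h => h
  have hforward : (∃ (α : Type v) (_ : LinearOrder α) (M : Matroid α),
      M.Finite ∧ Nonempty (L ≃o M.ExternalOrder)) →
      IsJoinDistributive L ∧ IsMatroidalLattice L ∧ IsSnELShellable L ∧ IsSupersolvable L := by
    rintro ⟨α, _, M, hM, ⟨f⟩⟩
    have hrep := Matroid.isSupersolvableRep_passiveRep f
    obtain ⟨n, ψ, hψ, hn⟩ := hrep.exists_normalized OrderDual.toDual.injective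
    exact ⟨hrep.isJoinDistributive, Matroid.isMatroidalLattice_of_orderIso f,
      hψ.isSnELShellable hn, hψ.isSupersolvable hn⟩
  refine ⟨⟨fun h => ?_, fun ⟨hJ, hL, hS⟩ => ?_⟩, ⟨fun h => ?_, fun ⟨hJ, hL, hS⟩ => ?_⟩⟩
  · obtain ⟨h1, h2, h3, -⟩ := hforward h
    exact ⟨h1, h2, h3⟩
  · obtain ⟨n, ψ, hψ, -⟩ := hJ.exists_rep_of_isSnELShellable hS
    exact ⟨ULift.{v} ℕᵒᵈ, inferInstance, hψ.exists_orderIso_externalOrder hL hσ⟩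
  · obtain ⟨h1, h2, -, h4⟩ := hforward h
    exact ⟨h1, h2, h4⟩
  · obtain ⟨n, ψ, hψ, -⟩ := hJ.exists_rep_of_isSupersolvable hS
    exact ⟨ULift.{v} ℕᵒᵈ, inferInstance, hψ.exists_orderIso_externalOrder hL hσ⟩
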